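/- All graphs are finite and simple. A graph is *distance-hereditary* if every connected induced subgraph preserves distances, and DH $\cap$ co-DH is the class of graphs $G$ such that both $G$ and its complement $\overline G$ are distance-hereditary. A *split* of $G=(V,E)$ is a bipartition $(A,B)$ of $V$ with $|A|,|B|\ge 2$ such that every vertex of $A$ having a neighbour in $B$ is adjacent to every vertex of $B$ having a neighbour in $A$. It is *strong* if for every split $(A',B')$ one of $A\cap A'$, $B\cap A'$, $A\cap B'$, $B\cap B'$ is empty. The *(canonical) split decomposition* $(T,\mu)$ of a connected graph $G$ with at least two vertices consists of a tree $T$ whose leaves are in bijection with $V$ and whose internal nodes have degree at least $3$, such that the strong splits of $G$ are exactly the bipartitions of $V$ induced by the components of $T-e$ for edges $e$ of $T$ joining two internal nodes, together with, for each internal node $t$, a label $\mu(t)$: the subgraph of $G$ induced by one vertex picked in each subtree incident to $t$, where the picked vertex must have a neighbour in $G$ outside that subtree. The vertices of $\mu(t)$ are thus in bijection with the edges of $T$ incident to $t$. An internal node is called a star node (clique node) if its label is a star (a clique). A star node $t$ *points towards* a node or an edge of $T$ different from $t$ if the path of $T$ from $t$ leading to it (and including it) contains the edge incident to $t$ to which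 the centre of the star $\mu(t)$ is mapped. **Theorem.** Let $G$ be a connected graph with at least two vertices, with split decomposition $(T,\mu)$. Then $G$ is in DH $\cap$ co-DH if and only if every internal node of $T$ is labelled by a star or a clique and at least one of the following holds: 1. there is an edge $e$ of $T$ such that all star nodes point towards $e$; 2. there are two star nodes $s,s'$, adjacent in $T$, neither pointing towards the other, such that all star nodes other than $s,s'$ point towards $s$ and $s'$; 3. there are two distinct star nodes $s,s'$, neither pointing towards the other, and a clique node $s''$ adjacent in $T$ to both $s$ and $s'$ (so $s''$ is the only node strictly between them), such that all star nodes other than $s,s'$ point towards $s$, $s'$ and $s''$. -/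

import Mathlib

/-- A graph is distance-hereditary if its connected induced subgraphs preserve distances. -/
def IsDistanceHereditary {V : Type*} (G : SimpleGraph V) : Prop :=
  ∀ S : Set V, (G.induce S).Connected → ∀ x y : S, (G.induce S).dist x y = G.dist x y

/-- The bipartition `(A, Aᶜ)` of the vertex set is a split of `G`: both sides have at least two
vertices, and every vertex of `A` with a neighbour in `Aᶜ` is adjacent to every vertex of `Aᶜ`
with a neighbour in `A`. -/
def IsSplit {V : Type*} (G : SimpleGraph V) (A : Set V) : Prop :=
  A.Nontrivial ∧ Aᶜ.Nontrivial ∧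
    ∀ a ∈ A, ∀ b ∈ Aᶜ, (∃ b' ∈ Aᶜ, G.Adj a b') → (∃ a' ∈ A, G.Adj b a') → G.Adj a b

/-- A split is strong if it overlaps no other split. -/
def IsStrongSplit {V : Type*} (G : SimpleGraph V) (A : Set V) : Prop :=
  IsSplit G A ∧ ∀ B : Set V, IsSplit G B →
    A ∩ B = ∅ ∨ Aᶜ ∩ B = ∅ ∨ A ∩ Bᶜ = ∅ ∨ Aᶜ ∩ Bᶜ = ∅

/-- `H` is a star with centre `c`. -/
def IsStarWithCenter {W : Type*} (H : SimpleGraph W) (c : W) : Prop :=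
  ∀ u w : W, H.Adj u w ↔ u ≠ w ∧ (u = c ∨ w = c)

/-- For an edge `tu` of the tree `T` with leaves given by `leaf`: the set of those `v` whose leaf
lies on the side of `u` after deletion of the edge `tu`. -/
def branchAt {V N : Type*} (T : SimpleGraph N) (leaf : V → N) (t u : N) : Set V :=
  {v | (T.deleteEdges {s(t, u)}).Reachable u (leaf v)}

/-- The canonical split decomposition `(T, μ)` of a graph `G`, with `N` the set of nodes of `T`.
The labels `μ` are recorded by the representatives `rep`, see `label`. -/
structure CanonicalSplitDecomposition {V : Type*} (G : SimpleGraph V) (N : Type*) where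
  /-- the decomposition tree -/
  T : SimpleGraph N
  finite : Finite N
  isTree : T.IsTree
  /-- the bijection from the vertices of `G` to the leaves of `T` -/
  leaf : V → N
  leaf_injective : Function.Injective leaf
  range_leaf : Set.range leaf = {t | (T.neighborSet t).ncard = 1}
  /-- internal nodes have degree at least three -/
  three_le_degree : ∀ t, t ∉ Set.range leaf → 3 ≤ (T.neighborSet t).ncard
  /-- the strong splits of `G` are exactly the bipartitions given by the internal edges of `T` -/
  isStrongSplit_iff : ∀ A : Set V, IsStrongSplit G A ↔
    ∃ t u : N, t ∉ Set.range leaf ∧ u ∉ Set.range leaf ∧ T.Adj t u ∧ A = branchAt T leaf t u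
  /-- for an internal node `t` and a tree edge `tu`, the vertex of `G` picked in the subtree at
  `u`; it must have a neighbour outside that subtree (all such choices give the same label) -/
  rep : N → N → V
  rep_mem : ∀ t u : N, t ∉ Set.range leaf → T.Adj t u → rep t u ∈ branchAt T leaf t u
  rep_adj : ∀ t u : N, t ∉ Set.range leaf → T.Adj t u →
    ∃ w, w ∉ branchAt T leaf t u ∧ G.Adj (rep t u) w

namespace CanonicalSplitDecomposition

/-- An internal node is a node that is not a leaf. -/
def IsInternal {V N : Type*} {G : SimpleGraph V} (D : CanonicalSplitDecomposition G N)
    (t : N) : Prop :=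
  t ∉ Set.range D.leaf

/-- The label `μ(t)`: the subgraph of `G` induced by the picked vertices, viewed as a graph on the
edges `tu` of `T` at `t`, which are identified with the neighbours `u` of `t`. -/
def label {V N : Type*} {G : SimpleGraph V} (D : CanonicalSplitDecomposition G N) (t : N) :
    SimpleGraph (D.T.neighborSet t) :=
  G.comap fun u => D.rep t u

/-- The internal node `t` is labelled by a clique. -/
def IsCliqueNode {V N : Type*} {G : SimpleGraph V} (D : CanonicalSplitDecomposition G N)
    (t : N) : Prop :=
  D.IsInternal t ∧ D.label t = ⊤

/-- The internal node `t` is labelled by a star whose centre is mapped to the tree edge `tc`. -/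
def IsStarNodeWithCenter {V N : Type*} {G : SimpleGraph V}
    (D : CanonicalSplitDecomposition G N) (t : N) (c : D.T.neighborSet t) : Prop :=
  D.IsInternal t ∧ IsStarWithCenter (D.label t) c

/-- The internal node `t` is labelled by a star. -/
def IsStarNode {V N : Type*} {G : SimpleGraph V} (D : CanonicalSplitDecomposition G N)
    (t : N) : Prop :=
  ∃ c, D.IsStarNodeWithCenter t c

/-- The star node `t` points towards the node `x`: the path of `T` from `t` to `x` contains the
edge to which the centre of the star is mapped. -/
def PointsTowardNode {V N : Type*} {G : SimpleGraph V} (D : CanonicalSplitDecomposition G N)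
    (t x : N) : Prop :=
  ∃ c, D.IsStarNodeWithCenter t c ∧ ∃ p : D.T.Walk t x, p.IsPath ∧ s(t, (c : N)) ∈ p.edges

/-- The star node `t` points towards the edge `e`: the path of `T` from `t` that ends by traversing
`e` contains the edge to which the centre of the star is mapped. -/
def PointsTowardEdge {V N : Type*} {G : SimpleGraph V} (D : CanonicalSplitDecomposition G N)
    (t : N) (e : Sym2 N) : Prop :=
  ∃ c, D.IsStarNodeWithCenter t c ∧
    ∃ x ∈ e, ∃ p : D.T.Walk t x, p.IsPath ∧ e ∈ p.edges ∧ s(t, (c : N)) ∈ p.edges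

end CanonicalSplitDecomposition

/-! In an induced path `a b c d` the ends are at distance three, so in a distance-hereditary graph
no vertex is adjacent to both `a` and `d`. The complement turns the path into `b d a c`, with ends
`b` and `c`, so if the complement is distance-hereditary too, no vertex misses both `b` and `c`.
Together the two prohibitions (`P4Condition`) bound distances by three and are therefore also
sufficient. The theorem becomes a statement about induced four-vertex paths, to be read off the
decomposition tree.

Labels: a split of a label lifts to a split of `G`. The lift is not a strong split, as the strong
splits are the tree edges, so some split of `G` crosses it, and the crossing split descends to the
label. A connected distance-hereditary graph all of whose splits are crossed is a clique or a star
(`eq_top_or_star_of_forall_crossed`).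

Stars: with such labels, distinct vertices are non-adjacent exactly when the tree path between them
passes some star node through two non-central edges (`Blocks`, `exists_blocks`). In an induced path
`a b c d`, a star blocking `a`, `c` and a star blocking `b`, `d` diverge, meaning that neither
points towards the other. Conversely, a closest diverging pair yields an induced path, and any
further star not pointing towards the pair yields a vertex missing both inner vertices. So
`P4Condition` holds exactly when there is no diverging pair, or there is one towards which all other
stars point.

Without diverging pairs, a star whose centre branch is smallest provides the common edge of
alternative 1. Between a pair as above there are no star nodes, and two clique nodes are never
adjacent in the canonical tree, so at most one clique node lies between: alternatives 2 and 3. -/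

namespace SimpleGraph

/-! ### Induced four-vertex paths and distance-hereditary graphs. -/

/-- For every induced path `a b c d`, each vertex is adjacent to an inner vertex of the path and
is not adjacent to both of its ends. -/
def P4Condition {V : Type*} (G : SimpleGraph V) : Prop :=
  ∀ a b c d x, G.Adj a b → G.Adj b c → G.Adj c d → ¬ G.Adj a c → ¬ G.Adj b d → ¬ G.Adj a d →
    (G.Adj x b ∨ G.Adj x c) ∧ ¬ (G.Adj x a ∧ G.Adj x d)

theorem P4Condition.comap {V W : Type*} {G : SimpleGraph V} (h : G.P4Condition) (f : W → V) :
    (G.comap f).P4Condition :=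
  fun a b c d x => h (f a) (f b) (f c) (f d) (f x)

/-- The complement of the path `a b c d` is the path `b d a c`: ends and inner vertices change
places, and with them the two halves of the condition. -/
theorem P4Condition.compl {V : Type*} {G : SimpleGraph V} (h : G.P4Condition) :
    Gᶜ.P4Condition := by
  intro a b c d x hab hbc hcd hac hbd had
  simp only [compl_adj] at *
  have e1 : a ≠ c := by rintro rfl; exact had ⟨hcd.1, hcd.2⟩
  have e2 : b ≠ d := by rintro rfl; exact had ⟨hab.1, hab.2⟩
  have e3 : a ≠ d := by rintro rfl; exact hac ⟨hcd.1.symm, fun h => hcd.2 h.symm⟩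
  have f1 : G.Adj a c := by tauto
  have f2 : G.Adj b d := by tauto
  have f3 : G.Adj a d := by tauto
  obtain ⟨k1, k2⟩ := h b d a c x f2 f3.symm f1 (fun h => hab.2 h.symm) (fun h => hcd.2 h.symm) hbc.2
  constructor
  · by_contra hx
    rw [not_or, not_and, not_and, not_not, not_not] at hx
    by_cases hxb : x = b
    · subst hxb; exact hbc.2 (hx.2 hbc.1)
    by_cases hxc : x = c
    · subst hxc; exact hbc.2 (hx.1 (Ne.symm hbc.1)).symm
    exact k2 ⟨hx.1 hxb, hx.2 hxc⟩
  · tauto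

theorem eq_or_adj_or_exists_of_dist_le_two {V : Type*} {G : SimpleGraph V} {u v : V}
    (hr : G.Reachable u v) (h : G.dist u v ≤ 2) :
    u = v ∨ G.Adj u v ∨ ∃ z, G.Adj u z ∧ G.Adj z v := by
  obtain ⟨p, hp⟩ := hr.exists_walk_length_eq_dist
  rw [← hp] at h
  match p, h with
  | .nil, _ => exact Or.inl rfl
  | .cons h1 .nil, _ => exact Or.inr (Or.inl h1)
  | .cons h1 (.cons h2 .nil), _ => exact Or.inr (Or.inr ⟨_, h1, h2⟩)
  | .cons _ (.cons _ (.cons _ q)), h => simp only [Walk.length_cons] at h; omega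

theorem preconnected_iff_exists_adj {V : Type*} {G : SimpleGraph V} :
    G.Preconnected ↔
      ∀ A : Set V, A.Nonempty → Aᶜ.Nonempty → ∃ a ∈ A, ∃ b ∈ Aᶜ, G.Adj a b := by
  constructor
  · rintro h A ⟨a, ha⟩ ⟨b, hb⟩
    obtain ⟨p⟩ := h a b
    obtain ⟨d, -, hd1, hd2⟩ := p.exists_boundary_dart A ha hb
    exact ⟨_, hd1, _, hd2, d.adj⟩
  · intro h u v
    by_contra huv
    obtain ⟨a, ha, b, hb, hab⟩ := h {w | G.Reachable u w} ⟨u, Reachable.refl _⟩ ⟨v, huv⟩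
    exact hb (Reachable.trans ha hab.reachable)

/-- In a connected graph satisfying the condition on induced paths, shortest paths have length at
most three. -/
theorem P4Condition.eq_or_path {V : Type*} {G : SimpleGraph V} (h : G.P4Condition)
    (hG : G.Preconnected) (x y : V) :
    x = y ∨ G.Adj x y ∨ (∃ z, G.Adj x z ∧ G.Adj z y) ∨
      ∃ b c, G.Adj x b ∧ G.Adj b c ∧ G.Adj c y := by
  by_contra hxy
  -- If some `y` were too far away, an edge `d e` would leave the set of vertices at distance at
  -- most three from `x`.
  obtain ⟨d, hd, e, he, hde⟩ := preconnected_iff_exists_adj.1 hG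
    {y | x = y ∨ G.Adj x y ∨ (∃ z, G.Adj x z ∧ G.Adj z y) ∨
      ∃ b c, G.Adj x b ∧ G.Adj b c ∧ G.Adj c y} ⟨x, Or.inl rfl⟩ ⟨y, hxy⟩
  apply he
  by_cases h1 : x = d
  · subst h1; exact Or.inr (Or.inl hde)
  by_cases h2 : G.Adj x d
  · exact Or.inr (Or.inr (Or.inl ⟨d, h2, hde⟩))
  by_cases h3 : ∃ z, G.Adj x z ∧ G.Adj z d
  · obtain ⟨z, hz1, hz2⟩ := h3
    exact Or.inr (Or.inr (Or.inr ⟨z, d, hz1, hz2, hde⟩))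
  obtain h | h | h | ⟨b, c, hxb, hbc, hcd⟩ := hd
  · exact absurd h h1
  · exact absurd h h2
  · exact absurd h h3
  -- Here `x b c d` is induced, and `e` sees `b` or `c`, which brings it back within distance three.
  · rcases (h x b c d e hxb hbc hcd (fun k => h3 ⟨c, k, hcd⟩) (fun k => h3 ⟨b, hxb, k⟩) h2).1
      with k | k
    · exact Or.inr (Or.inr (Or.inl ⟨b, hxb, k.symm⟩))
    · exact Or.inr (Or.inr (Or.inr ⟨b, c, hxb, hbc, k.symm⟩))

/-- Induced distances are at most three and adjacency is inherited, so the only possible discrepancy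
is three against two. The middle vertex of the short path would then be adjacent to both ends of an
induced path. -/
theorem P4Condition.isDistanceHereditary {V : Type*} {G : SimpleGraph V} (h : G.P4Condition) :
    IsDistanceHereditary G := by
  intro S hS x y
  have hSc : (G.induce S).P4Condition := h.comap _
  have hle : G.dist x y ≤ (G.induce S).dist x y := by
    obtain ⟨p, hp⟩ := hS.exists_walk_length_eq_dist x y
    rw [← hp, ← Walk.length_map (Embedding.induce S).toHom p]
    exact dist_le _
  refine le_antisymm ?_ hle
  have hr : G.Reachable x y := (hS.preconnected x y).map (Embedding.induce S).toHom
  by_contra hlt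
  rw [not_le] at hlt
  have key : G.dist x y ≤ 2 := by
    have : (G.induce S).dist x y ≤ 3 := by
      rcases hSc.eq_or_path hS.preconnected x y with k | k | ⟨z, k1, k2⟩ | ⟨b, c, k1, k2, k3⟩
      · subst k; simp
      · exact (dist_le (Walk.cons k Walk.nil)).trans (by simp)
      · exact (dist_le (Walk.cons k1 (Walk.cons k2 Walk.nil))).trans (by simp)
      · exact (dist_le (Walk.cons k1 (Walk.cons k2 (Walk.cons k3 Walk.nil)))).trans (by simp)
    omega
  rcases hSc.eq_or_path hS.preconnected x y with k | k | ⟨z, k1, k2⟩ | ⟨b, c, k1, k2, k3⟩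
  · subst k; simp at hlt
  · rw [dist_eq_one_iff_adj.2 k, Nat.lt_one_iff, hr.dist_eq_zero_iff] at hlt
    exact k.ne (Subtype.ext hlt)
  · have h2 := dist_le (Walk.cons k1 (Walk.cons k2 Walk.nil))
    simp only [Walk.length_cons, Walk.length_nil] at h2
    have h1 : G.dist x y ≤ 1 := by omega
    rcases Nat.le_one_iff_eq_zero_or_eq_one.1 h1 with h0 | h0
    · rw [hr.dist_eq_zero_iff] at h0
      have : x = y := Subtype.ext h0
      subst this; simp at hlt
    · rw [dist_eq_one_iff_adj] at h0
      rw [dist_eq_one_iff_adj.2 h0, dist_eq_one_iff_adj.2 (show (G.induce S).Adj x y from h0)] at hlt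
      exact lt_irrefl _ hlt
  · have h3 := dist_le (Walk.cons k1 (Walk.cons k2 (Walk.cons k3 Walk.nil)))
    simp only [Walk.length_cons, Walk.length_nil] at h3
    have nxy : ¬ G.Adj x y := by
      intro h0
      rw [dist_eq_one_iff_adj.2 h0, dist_eq_one_iff_adj.2 (show (G.induce S).Adj x y from h0)] at hlt
      exact lt_irrefl _ hlt
    rcases eq_or_adj_or_exists_of_dist_le_two hr key with k | k | ⟨z, m1, m2⟩
    · have : x = y := Subtype.ext k
      subst this; simp at hlt
    · exact nxy k
    · have hn2 : ∀ w : S, G.Adj x w → ¬ G.Adj w y := by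
        intro w hw1 hw2
        have h2 := dist_le (Walk.cons (show (G.induce S).Adj x w from hw1)
          (Walk.cons (show (G.induce S).Adj w y from hw2) Walk.nil))
        simp only [Walk.length_cons, Walk.length_nil] at h2
        have h1 : G.dist x y ≤ 1 := by omega
        rcases Nat.le_one_iff_eq_zero_or_eq_one.1 h1 with h0 | h0
        · rw [hr.dist_eq_zero_iff] at h0
          have : x = y := Subtype.ext h0
          subst this; simp at hlt
        · exact nxy (dist_eq_one_iff_adj.1 h0)
      exact (h x b c y z k1 k2 k3 (fun k => hn2 c k k3) (fun k => hn2 b k1 k) nxy).2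
        ⟨m1.symm, m2⟩

theorem not_adj_ends_of_isDistanceHereditary {V : Type*} {G : SimpleGraph V}
    (h : IsDistanceHereditary G) {a b c d x : V} (hab : G.Adj a b) (hbc : G.Adj b c)
    (hcd : G.Adj c d) (hac : ¬ G.Adj a c) (hbd : ¬ G.Adj b d) (had : ¬ G.Adj a d) :
    ¬ (G.Adj x a ∧ G.Adj x d) := by
  rintro ⟨hxa, hxd⟩
  let S : Set V := {a, b, c, d}
  let a' : S := ⟨a, by simp [S]⟩
  let b' : S := ⟨b, by simp [S]⟩
  let c' : S := ⟨c, by simp [S]⟩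
  let d' : S := ⟨d, by simp [S]⟩
  have ab : (G.induce S).Adj a' b' := hab
  have bc : (G.induce S).Adj b' c' := hbc
  have cd : (G.induce S).Adj c' d' := hcd
  have hS : (G.induce S).Connected := by
    rw [connected_iff_exists_forall_reachable]
    refine ⟨b', ?_⟩
    rintro ⟨w, rfl | rfl | rfl | rfl⟩
    · exact ab.reachable.symm
    · exact Reachable.refl _
    · exact bc.reachable
    · exact bc.reachable.trans cd.reachable
  have h2 : G.dist a d ≤ 2 := (dist_le (Walk.cons hxa.symm (Walk.cons hxd Walk.nil))).trans (by simp)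
  rw [← h S hS a' d'] at h2
  rcases eq_or_adj_or_exists_of_dist_le_two (hS.preconnected a' d') h2 with k | k | ⟨⟨z, hz⟩, m1, m2⟩
  · have : a = d := congrArg Subtype.val k
    subst this; exact hac hcd.symm
  · exact had k
  · have m1 : G.Adj a z := m1
    have m2 : G.Adj z d := m2
    rcases hz with rfl | rfl | rfl | rfl
    · exact had m2
    · exact hbd m2
    · exact hac m1
    · exact had m1

theorem isDistanceHereditary_and_compl_iff {V : Type*} {G : SimpleGraph V} :
    IsDistanceHereditary G ∧ IsDistanceHereditary Gᶜ ↔ G.P4Condition := by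
  refine ⟨fun ⟨h, h'⟩ => ?_, fun h => ⟨h.isDistanceHereditary, h.compl.isDistanceHereditary⟩⟩
  intro a b c d x hab hbc hcd hac hbd had
  refine ⟨?_, not_adj_ends_of_isDistanceHereditary h hab hbc hcd hac hbd had⟩
  by_contra hx
  rw [not_or] at hx
  have e1 : a ≠ c := by rintro rfl; exact had hcd
  have e2 : b ≠ d := by rintro rfl; exact had hab
  have e3 : a ≠ d := by rintro rfl; exact hac hcd.symm
  have hxb : x ≠ b := by rintro rfl; exact hx.2 hbc
  have hxc : x ≠ c := by rintro rfl; exact hx.1 hbc.symm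
  refine not_adj_ends_of_isDistanceHereditary h' (a := b) (b := d) (c := a) (d := c) (x := x)
    ?_ ?_ ?_ ?_ ?_ ?_ ⟨?_, ?_⟩ <;> simp only [compl_adj, not_and, not_not] <;>
    grind [adj_comm]

/-! ### Cuts, that is, splits without the size condition. -/

/-- The adjacency condition in the definition of a split. -/
def IsCut {V : Type*} (G : SimpleGraph V) (A : Set V) : Prop :=
  ∀ a ∈ A, ∀ b ∈ Aᶜ, (∃ b' ∈ Aᶜ, G.Adj a b') → (∃ a' ∈ A, G.Adj b a') → G.Adj a b

section Cut

variable {V : Type*} {G : SimpleGraph V} {A B : Set V}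

theorem IsCut.compl (h : G.IsCut A) : G.IsCut Aᶜ := by
  intro a ha b hb h1 h2
  rw [compl_compl] at hb h1
  exact (h b hb a ha h2 h1).symm

theorem isCut_of_subsingleton (h : A.Subsingleton) : G.IsCut A := by
  rintro a ha b hb - ⟨a', ha', hba'⟩
  rw [h ha ha']
  exact hba'.symm

theorem isCut_compl_iff : G.IsCut Aᶜ ↔ G.IsCut A :=
  ⟨fun h => compl_compl A ▸ h.compl, IsCut.compl⟩

/-- The difficult case has `a` with a neighbour in `A \ B` and `b` in `B \ A`. Connectedness
supplies an edge leaving `A ∪ B`, and the two cut conditions move its inner end to `a`; then the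
condition for `A` joins `a` to `b`. -/
theorem IsCut.inter (hG : G.Preconnected) (hA : G.IsCut A) (hB : G.IsCut B)
    (h : (A ∪ B)ᶜ.Nonempty) : G.IsCut (A ∩ B) := by
  have aux : ∀ {A B : Set V}, G.IsCut A → G.IsCut B → (A ∪ B)ᶜ.Nonempty →
      ∀ a ∈ A ∩ B, ∀ b ∈ B, b ∉ A → ∀ y ∈ A, y ∉ B → ∀ x ∈ A ∩ B, G.Adj a y → G.Adj b x →
        G.Adj a b := by
    intro A B hA hB h a ha b hbB hbA y hyA hyB x hx hay hbx
    have key : ∃ s, s ∉ A ∧ s ∉ B ∧ G.Adj a s := by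
      obtain ⟨z, hz, s, hs, hzs⟩ := preconnected_iff_exists_adj.1 hG (A ∪ B) ⟨a, Or.inl ha.1⟩ h
      simp only [Set.mem_compl_iff, Set.mem_union, not_or] at hs
      refine ⟨s, hs.1, hs.2, ?_⟩
      by_cases hzB : z ∈ B
      · exact hB a ha.2 s hs.2 ⟨y, hyB, hay⟩ ⟨z, hzB, hzs.symm⟩
      · have hzA : z ∈ A := by
          rcases hz with hz | hz
          · exact hz
          · exact absurd hz hzB
        have hxs := hA x hx.1 s hs.1 ⟨b, hbA, hbx.symm⟩ ⟨z, hzA, hzs.symm⟩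
        exact hB a ha.2 s hs.2 ⟨y, hyB, hay⟩ ⟨x, hx.2, hxs.symm⟩
    obtain ⟨s, hsA, -, has⟩ := key
    exact hA a ha.1 b hbA ⟨s, hsA, has⟩ ⟨x, hx.1, hbx⟩
  rintro a ha b hb ⟨y, hy, hay⟩ ⟨x, hx, hbx⟩
  by_cases hbA : b ∈ A
  · have hbB : b ∉ B := fun k => hb ⟨hbA, k⟩
    by_cases hyB : y ∈ B
    · have hyA : y ∉ A := fun k => hy ⟨k, hyB⟩
      exact aux hB hA (by rwa [Set.union_comm]) a ha.symm b hbA hbB y hyB hyA x hx.symm hay hbx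
    · exact hB a ha.2 b hbB ⟨y, hyB, hay⟩ ⟨x, hx.2, hbx⟩
  · by_cases hyA : y ∈ A
    · have hyB : y ∉ B := fun k => hy ⟨hyA, k⟩
      by_cases hbB : b ∈ B
      · exact aux hA hB h a ha b hbB hbA y hyA hyB x hx hay hbx
      · exact hB a ha.2 b hbB ⟨y, hyB, hay⟩ ⟨x, hx.2, hbx⟩
    · exact hA a ha.1 b hbA ⟨y, hyA, hay⟩ ⟨x, hx.1, hbx⟩

/-- A violation of the cut condition involves only two vertices of `A`. -/
theorem isCut_of_pairs (h : ∀ x ∈ A, ∀ y ∈ A, x ≠ y → G.IsCut {x, y}) : G.IsCut A := by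
  rintro x hx b hb ⟨b', hb', hxb'⟩ ⟨x', hx', hbx'⟩
  by_cases hxx : x = x'
  · subst hxx; exact hbx'.symm
  have n : ∀ z ∈ Aᶜ, z ∈ ({x, x'} : Set V)ᶜ := by
    rintro z hz (rfl | rfl)
    · exact hz hx
    · exact hz hx'
  exact h x hx x' hx' hxx x (by simp) b (n b hb) ⟨b', n b' hb', hxb'⟩ ⟨x', by simp, hbx'⟩

/-- In other words, the neighbourhoods of `u` and `v` outside the pair agree, or one of them is
empty. -/
theorem isCut_pair_iff {u v : V} : G.IsCut {u, v} ↔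
    (∀ b b', b ≠ u → b ≠ v → b' ≠ u → b' ≠ v → G.Adj u b' → G.Adj v b → G.Adj u b) ∧
    (∀ b b', b ≠ u → b ≠ v → b' ≠ u → b' ≠ v → G.Adj v b' → G.Adj u b → G.Adj v b) := by
  constructor
  · intro h
    constructor
    · intro b b' h1 h2 h3 h4 h5 h6
      exact h u (by simp) b (by simp [h1, h2]) ⟨b', by simp [h3, h4], h5⟩ ⟨v, by simp, h6.symm⟩
    · intro b b' h1 h2 h3 h4 h5 h6
      exact h v (by simp) b (by simp [h1, h2]) ⟨b', by simp [h3, h4], h5⟩ ⟨u, by simp, h6.symm⟩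
  · rintro ⟨h1, h2⟩ a ha b hb ⟨b', hb', hab'⟩ ⟨a', ha', hba'⟩
    simp only [Set.mem_insert_iff, Set.mem_singleton_iff, Set.mem_compl_iff, not_or] at *
    rcases ha with rfl | rfl <;> rcases ha' with rfl | rfl
    · exact hba'.symm
    · exact h1 b b' hb.1 hb.2 hb'.1 hb'.2 hab' hba'.symm
    · exact h2 b b' hb.1 hb.2 hb'.1 hb'.2 hab' hba'.symm
    · exact hba'.symm

/-- Makes being a cut pair an equivalence relation. An isolated `v` would form a cut with
everything, hence the hypothesis on neighbours. -/
theorem IsCut.pair_trans (hG : ∀ v, ∃ w, G.Adj v w) {u v w : V} (huv : u ≠ v) (hvw : v ≠ w)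
    (huw : u ≠ w) (h1 : G.IsCut {u, v}) (h2 : G.IsCut {v, w}) : G.IsCut {u, w} := by
  have aux : ∀ {u v w : V}, u ≠ v → v ≠ w → u ≠ w → G.IsCut {u, v} → G.IsCut {v, w} →
      ∀ b b', b ≠ u → b ≠ w → b' ≠ u → b' ≠ w → G.Adj u b' → G.Adj w b → G.Adj u b := by
    intro u v w huv hvw huw h1 h2 b b' hb1 hb2 hb3 hb4 hub hwb
    rw [isCut_pair_iff] at h1 h2
    obtain ⟨z, hz⟩ := hG v
    obtain ⟨h1a, h1b⟩ := h1
    obtain ⟨h2a, h2b⟩ := h2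
    have e1 : b' ≠ u := hub.ne'
    have e2 : b ≠ w := hwb.ne'
    have e3 : z ≠ v := hz.ne'
    by_cases hbv : b = v
    · subst hbv
      by_cases hb' : b' = b
      · rwa [← hb']
      have k1 := h1a w b' huw.symm hvw.symm e1 hb' hub hwb.symm
      have k2 := h1b b' w e1 hb' huw.symm hvw.symm hwb.symm hub
      exact (h2a u b' huv huw hb' hb4 k2 k1.symm).symm
    by_cases hb' : b' = v
    · subst hb'
      have k1 := h2b u b huv huw hbv e2 hwb hub.symm
      have k2 := h2a b u hbv e2 huv huw hub.symm hwb
      exact h1a b w hb1 hbv huw.symm hvw.symm k1.symm k2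
    by_cases hzw : z = w
    · subst hzw
      have k1 := h1a z b' huw.symm hvw.symm e1 hb' hub hz
      have k2 := h1b b' z e1 hb' huw.symm hvw.symm hz hub
      have k3 := h2a b b' hbv e2 hb' hb4 k2 hwb
      exact h1a b b' hb1 hbv e1 hb' hub k3
    · have k3 := h2a b z hbv e2 e3 hzw hz hwb
      exact h1a b b' hb1 hbv e1 hb' hub k3
  have s : ∀ x y : V, ({x, y} : Set V) = {y, x} := fun x y => Set.pair_comm x y
  rw [isCut_pair_iff]
  refine ⟨aux huv hvw huw h1 h2, ?_⟩
  intro b b' h3 h4 h5 h6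
  exact aux hvw.symm huv.symm huw.symm (s v w ▸ h2) (s u v ▸ h1) b b' h4 h3 h6 h5

/-- A non-complete graph contains an induced path `u v w`. The cut condition for pairs makes `v` the
only neighbour of `u`, then makes `v` adjacent to everything, and finally excludes edges avoiding
`v`. -/
theorem eq_top_or_star_of_forall_isCut (hG : G.Preconnected) (h : ∀ A, G.IsCut A) :
    G = ⊤ ∨ ∃ c, IsStarWithCenter G c := by
  by_cases hK : ∀ x y, x ≠ y → G.Adj x y
  · left; ext x y; exact ⟨fun k => k.ne, hK x y⟩
  right
  push Not at hK
  obtain ⟨x, y, hne, hxy⟩ := hK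
  have hp : ∃ u v w, G.Adj u v ∧ G.Adj v w ∧ ¬ G.Adj u w ∧ u ≠ w := by
    obtain ⟨a, ha, b, hb, hab⟩ := preconnected_iff_exists_adj.1 hG {z | z = x ∨ G.Adj x z}
      ⟨x, Or.inl rfl⟩ ⟨y, by simp [hne.symm, hxy]⟩
    rcases ha with rfl | ha
    · exact absurd (Or.inr hab) hb
    · exact ⟨x, a, b, ha, hab, fun k => hb (Or.inr k), fun k => hb (Or.inl k.symm)⟩
  obtain ⟨u, v, w, huv, hvw, huw, hne'⟩ := hp
  have pr : ∀ p q b b', b ≠ p → b ≠ q → b' ≠ p → b' ≠ q → G.Adj p b' → G.Adj q b → G.Adj p b :=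
    fun p q => (isCut_pair_iff.1 (h {p, q})).1
  have nu : ∀ z, z ≠ v → ¬ G.Adj u z := by
    intro z hz huz
    have := pr u v w z; have := huz.ne; have := huv.ne; have := hvw.ne
    grind [adj_comm]
  have all : ∀ z, z ≠ v → G.Adj v z := by
    intro z hz
    by_cases hzu : z = u
    · subst hzu; exact huv.symm
    have hnt : ∃ t, G.Adj z t := by
      obtain ⟨a, rfl, b, -, hb⟩ := preconnected_iff_exists_adj.1 hG {z} ⟨z, rfl⟩ ⟨v, Ne.symm hz⟩
      exact ⟨b, hb⟩
    obtain ⟨t, ht⟩ := hnt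
    by_contra hvz
    have := pr z u v t; have := nu z hz; have := ht.ne; have := huv.ne
    grind [adj_comm]
  refine ⟨v, fun p q => ⟨fun hpq => ⟨hpq.ne, ?_⟩, ?_⟩⟩
  · by_contra hc
    rw [not_or] at hc
    have := pr u p q v; have := nu p hc.1; have := nu q hc.2
    have := hpq.ne; have := huv.ne
    grind [adj_comm]
  · rintro ⟨hne, rfl | rfl⟩
    · exact all q hne.symm
    · exact (all p hne).symm

end Cut

end SimpleGraph

namespace SimpleGraph

/-! ### Splits of distance-hereditary graphs. -/

section Prime

variable {W : Type*} {G : SimpleGraph W}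

/-- In a distance-hereditary graph, a connected component of the graph induced by the non-neighbours
of `v` satisfies the adjacency condition of a split. -/
theorem isCut_of_isDistanceHereditary (h : IsDistanceHereditary G) (v x : W) (hxv : x ≠ v)
    (hx : ¬ G.Adj v x) :
    G.IsCut {w | Relation.ReflTransGen
      (fun y z => G.Adj y z ∧ z ≠ v ∧ ¬ G.Adj v z) x w} := by
  set C := {w | Relation.ReflTransGen (fun y z => G.Adj y z ∧ z ≠ v ∧ ¬ G.Adj v z) x w} with hC
  have far : ∀ w ∈ C, w ≠ v ∧ ¬ G.Adj v w := by
    intro w hw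
    rcases Relation.ReflTransGen.cases_tail hw with k | ⟨z, -, k⟩
    · subst k; exact ⟨hxv, hx⟩
    · exact k.2
  have near : ∀ w ∈ C, ∀ z, z ∉ C → G.Adj w z → G.Adj v z := by
    intro w hw z hz hwz
    by_contra hvz
    refine hz (Relation.ReflTransGen.tail hw ⟨hwz, ?_, hvz⟩)
    rintro rfl
    exact (far w hw).2 hwz.symm
  rintro a ha q hq ⟨p, hp, hap⟩ ⟨z, hz, hqz⟩
  have hvp := near a ha p hp hap
  have hvq := near z hz q hq hqz.symm
  -- `a` and `v` have distance two through `p`. In the connected set `S` the middle vertex can only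
  -- be `q`, since `C` contains no neighbour of `v`.
  let S : Set W := insert v (insert q C)
  have hS : (G.induce S).Connected := by
    rw [connected_iff_exists_forall_reachable]
    have hxC : x ∈ C := Relation.ReflTransGen.refl
    have hreach : ∀ w (hw : w ∈ C), (G.induce S).Reachable
        ⟨x, Or.inr (Or.inr hxC)⟩ ⟨w, Or.inr (Or.inr hw)⟩ := by
      intro w hw
      have hw' : Relation.ReflTransGen (fun y z => G.Adj y z ∧ z ≠ v ∧ ¬ G.Adj v z) x w := hw
      induction hw' with
      | refl => exact Reachable.refl _
      | tail h1 h2 ih => exact (ih h1).trans (Adj.reachable (by exact h2.1))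
    have hq' : (G.induce S).Reachable ⟨x, Or.inr (Or.inr hxC)⟩ ⟨q, Or.inr (Or.inl rfl)⟩ :=
      (hreach z hz).trans (Adj.reachable (by exact hqz.symm))
    refine ⟨⟨x, Or.inr (Or.inr hxC)⟩, ?_⟩
    rintro ⟨w, rfl | rfl | hw⟩
    · exact hq'.trans (Adj.reachable (by exact hvq.symm))
    · exact hq'
    · exact hreach w hw
  have h2 : G.dist a v ≤ 2 :=
    (dist_le (Walk.cons hap (Walk.cons hvp.symm Walk.nil))).trans (by simp)
  rw [← h S hS ⟨a, Or.inr (Or.inr ha)⟩ ⟨v, Or.inl rfl⟩] at h2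
  rcases eq_or_adj_or_exists_of_dist_le_two (hS.preconnected _ _) h2 with k | k | ⟨⟨w, hw⟩, k1, k2⟩
  · exact absurd (congrArg Subtype.val k) (far a ha).1
  · exact absurd (Adj.symm k) (far a ha).2
  · have k1 : G.Adj a w := k1
    have k2 : G.Adj w v := k2
    rcases hw with rfl | rfl | hw
    · exact absurd k2 (G.loopless.irrefl _)
    · exact k1
    · exact absurd k2.symm (far w hw).2

theorem _root_.Set.Nontrivial.compl_pair {A : Set W} (h : A.Nontrivial) (h' : Aᶜ.Nontrivial)
    (u w : W) : ({u, w} : Set W)ᶜ.Nontrivial := by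
  have aux : ∀ u w, u ∈ A → w ∉ A → ({u, w} : Set W)ᶜ.Nontrivial := by
    intro u w hu hw
    obtain ⟨p, hp, hpu⟩ := h.exists_ne u
    obtain ⟨r, hr, hrw⟩ := h'.exists_ne w
    refine ⟨p, ?_, r, ?_, fun k => hr (k ▸ hp)⟩
    · rintro (k | k)
      · exact hpu k
      · exact hw (k ▸ hp)
    · rintro (k | k)
      · exact hr (k ▸ hu)
      · exact hrw k
  by_cases hu : u ∈ A <;> by_cases hw : w ∈ A
  · refine h'.mono fun z hz => ?_
    rintro (rfl | rfl) <;> exact hz (by assumption)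
  · exact aux u w hu hw
  · rw [Set.pair_comm]
    exact aux w u hw hu
  · refine h.mono fun z hz => ?_
    rintro (rfl | rfl) <;> exact absurd hz (by assumption)

/-- If there is no split, a component of the non-neighbours of `v` has only one vertex, so these
non-neighbours are independent. Two non-adjacent vertices then have the same neighbours and form a
split, unless the graph is complete. -/
theorem forall_isCut_or_exists_isSplit (hG : G.Preconnected) (h : IsDistanceHereditary G) :
    (∀ A, G.IsCut A) ∨ ∃ A, IsSplit G A := by
  by_contra hc
  push Not at hc
  obtain ⟨⟨A, hA⟩, hno⟩ := hc
  have hA1 : A.Nontrivial := by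
    by_contra k
    rw [Set.not_nontrivial_iff] at k
    exact hA (isCut_of_subsingleton k)
  have hA2 : Aᶜ.Nontrivial := by
    by_contra k
    rw [Set.not_nontrivial_iff] at k
    exact hA (isCut_compl_iff.1 (isCut_of_subsingleton k))
  have nbr : ∀ v, ∃ w, G.Adj v w := by
    intro v
    have : ∃ w, w ≠ v := by
      obtain ⟨p, -, q, -, hpq⟩ := hA1
      by_cases hp : p = v
      · exact ⟨q, fun k => hpq (hp.trans k.symm)⟩
      · exact ⟨p, hp⟩
    obtain ⟨w, hw⟩ := this
    obtain ⟨a, rfl, b, -, hb⟩ := preconnected_iff_exists_adj.1 hG {v} ⟨v, rfl⟩ ⟨w, hw⟩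
    exact ⟨b, hb⟩
  have indep : ∀ v x y, x ≠ v → y ≠ v → ¬ G.Adj v x → ¬ G.Adj v y → ¬ G.Adj x y := by
    intro v x y hxv hyv hx hy hxy
    have hcut := isCut_of_isDistanceHereditary h v x hxv hx
    refine hno _ ⟨⟨x, Relation.ReflTransGen.refl, y, Relation.ReflTransGen.single ⟨hxy, hyv, hy⟩,
      hxy.ne⟩, ?_, hcut⟩
    obtain ⟨z, hz⟩ := nbr v
    refine ⟨v, ?_, z, ?_, hz.ne⟩
    · intro k
      rcases Relation.ReflTransGen.cases_tail k with k | ⟨_, -, k⟩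
      · exact hxv k.symm
      · exact k.2.1 rfl
    · intro k
      rcases Relation.ReflTransGen.cases_tail k with k | ⟨_, -, k⟩
      · subst k; exact hx hz
      · exact k.2.2 hz
  by_cases hK : ∀ x y, x ≠ y → G.Adj x y
  · exact hA fun a ha b hb _ _ => hK a b (fun k => hb (k ▸ ha))
  · push Not at hK
    obtain ⟨u, w, huw, hn⟩ := hK
    refine hno {u, w} ⟨⟨u, by simp, w, by simp, huw⟩, hA1.compl_pair hA2 u w, ?_⟩
    have aux : ∀ u w, u ≠ w → ¬ G.Adj u w → ∀ b, b ≠ u → G.Adj w b → G.Adj u b :=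
      fun u w h1 h2 b h3 h4 => by_contra fun k => indep u w b h1.symm h3 h2 k h4
    refine isCut_pair_iff.2 ⟨fun b _ hb _ _ _ _ => aux u w huw hn b hb, fun b _ _ hb _ _ _ => ?_⟩
    exact aux w u huw.symm (fun k => hn k.symm) b hb

/-- A connected distance-hereditary graph in which every split is crossed by another split is a
clique or a star. -/
theorem eq_top_or_star_of_forall_crossed [Finite W] (hG : G.Preconnected)
    (h : IsDistanceHereditary G)
    (hc : ∀ A, IsSplit G A → ∃ B, IsSplit G B ∧ (A ∩ B).Nonempty ∧ (Aᶜ ∩ B).Nonempty ∧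
      (A ∩ Bᶜ).Nonempty ∧ (Aᶜ ∩ Bᶜ).Nonempty) :
    G = ⊤ ∨ ∃ c, IsStarWithCenter G c := by
  rcases forall_isCut_or_exists_isSplit hG h with hall | hsplit
  · exact eq_top_or_star_of_forall_isCut hG hall
  apply eq_top_or_star_of_forall_isCut hG
  obtain ⟨A, hA, hmin⟩ := WellFounded.has_min (measure (Set.ncard (α := W))).wf
    {A | IsSplit G A} hsplit
  have nbr : ∀ v, ∃ w, G.Adj v w := by
    intro v
    have : ∃ w, w ≠ v := by
      obtain ⟨p, -, q, -, hpq⟩ := hA.1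
      by_cases hp : p = v
      · exact ⟨q, fun k => hpq (hp.trans k.symm)⟩
      · exact ⟨p, hp⟩
    obtain ⟨w, hw⟩ := this
    obtain ⟨a, rfl, b, -, hb⟩ := preconnected_iff_exists_adj.1 hG {v} ⟨v, rfl⟩ ⟨w, hw⟩
    exact ⟨b, hb⟩
  -- A smallest split `A` is a pair: a split crossing it cuts it into two smaller cuts, which must
  -- be singletons.
  have hpair : ∃ u v, u ≠ v ∧ G.IsCut {u, v} := by
    obtain ⟨B, hB, ⟨u, hu⟩, ⟨p, hp⟩, ⟨v, hv⟩, ⟨q, hq⟩⟩ := hc A hA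
    have small : ∀ B, G.IsCut B → (Aᶜ ∩ Bᶜ).Nonempty → (A ∩ Bᶜ).Nonempty →
        (A ∩ B).Subsingleton := by
      intro B hB hn hn'
      by_contra hs
      rw [Set.not_subsingleton_iff] at hs
      refine hmin (A ∩ B) ⟨hs, hA.2.1.mono (by simp), IsCut.inter hG hA.2.2 hB ?_⟩ ?_
      · rwa [Set.compl_union]
      · obtain ⟨z, hz⟩ := hn'
        exact Set.ncard_lt_ncard ⟨Set.inter_subset_left, fun k => hz.2 (k hz.1).2⟩
    have s1 := small B hB.2.2 ⟨q, hq⟩ ⟨v, hv⟩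
    have s2 := small Bᶜ (IsCut.compl hB.2.2) (by rw [compl_compl]; exact ⟨p, hp⟩)
      (by rw [compl_compl]; exact ⟨u, hu⟩)
    refine ⟨u, v, fun k => hv.2 (k ▸ hu.2), ?_⟩
    have : ({u, v} : Set W) = A := by
      ext z
      constructor
      · rintro (rfl | rfl)
        · exact hu.1
        · exact hv.1
      · intro hz
        by_cases hzB : z ∈ B
        · exact Or.inl (s1 ⟨hz, hzB⟩ hu)
        · exact Or.inr (s2 ⟨hz, hzB⟩ hv)
    rw [this]
    exact hA.2.2
  obtain ⟨u, v, huv, hcut⟩ := hpair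
  -- The class of `u` under the relation of forming a cut pair. All its subsets are cuts, so it
  -- suffices that at most one vertex lies outside.
  set C : Set W := {w | w = u ∨ G.IsCut {u, w}} with hC
  have hCpair : ∀ x ∈ C, ∀ y ∈ C, x ≠ y → G.IsCut {x, y} := by
    intro x hx y hy hxy
    by_cases hxu : x = u
    · subst hxu
      rcases hy with rfl | hy
      · exact absurd rfl hxy
      · exact hy
    by_cases hyu : y = u
    · subst hyu
      rcases hx with rfl | hx
      · exact absurd rfl hxy
      · rwa [Set.pair_comm]
    have hx' := hx.resolve_left hxu
    have hy' := hy.resolve_left hyu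
    rw [Set.pair_comm] at hx'
    exact IsCut.pair_trans nbr hxu (Ne.symm hyu) hxy hx' hy'
  have hCclosed : ∀ c ∈ C, ∀ b, b ≠ c → G.IsCut {b, c} → b ∈ C := by
    intro c hcC b hbc hb
    by_cases hbu : b = u
    · exact Or.inl hbu
    rcases hcC with rfl | hcC
    · rw [Set.pair_comm] at hb
      exact Or.inr hb
    by_cases hcu : c = u
    · subst hcu
      rw [Set.pair_comm] at hb
      exact Or.inr hb
    rw [Set.pair_comm] at hb
    exact Or.inr (IsCut.pair_trans nbr (Ne.symm hcu) hbc.symm (Ne.symm hbu) hcC hb)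
  have hCsub : ∀ X ⊆ C, G.IsCut X := fun X hX =>
    isCut_of_pairs fun x hx y hy => hCpair x (hX hx) y (hX hy)
  have hCnt : C.Nontrivial := ⟨u, Or.inl rfl, v, Or.inr hcut, huv⟩
  have hCs : Cᶜ.Subsingleton := by
    by_contra hs
    rw [Set.not_subsingleton_iff] at hs
    have hex : ∃ B, G.IsCut B ∧ (C ∩ B).Nonempty ∧ (Cᶜ ∩ B).Nonempty ∧ (C ∩ Bᶜ).Nonempty ∧
        (Cᶜ ∩ Bᶜ).Nonempty := by
      obtain ⟨B, hB, hB'⟩ := hc C ⟨hCnt, hs, hCsub C subset_rfl⟩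
      exact ⟨B, hB.2.2, hB'⟩
    -- Among the cuts crossing `C`, take one with the fewest vertices outside `C`. If `B \ C` is one
    -- vertex, it forms a cut pair with `c` and belongs to `C`. Otherwise `B \ C` is a split, and a
    -- cut `D` that crosses it and contains `c` makes `insert c (B \ C) ∩ D` a smaller choice.
    obtain ⟨B, ⟨hB, ⟨c, hcC, hcB⟩, ⟨b, hbC, hbB⟩, ⟨c', hc'C, hc'B⟩, ⟨b', hb'C, hb'B⟩⟩, hBmin⟩ :=
      WellFounded.has_min (measure fun B : Set W => (B \ C).ncard).wf
      {B | G.IsCut B ∧ (C ∩ B).Nonempty ∧ (Cᶜ ∩ B).Nonempty ∧ (C ∩ Bᶜ).Nonempty ∧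
        (Cᶜ ∩ Bᶜ).Nonempty} hex
    have hcut1 : G.IsCut (B \ C) := by
      rw [Set.sdiff_eq]
      refine IsCut.inter hG hB (hCsub C subset_rfl).compl ⟨c', ?_⟩
      simp only [Set.mem_compl_iff, Set.mem_union, not_or, not_not]
      exact ⟨hc'B, hc'C⟩
    have hcut2 : G.IsCut (insert c (B \ C)) := by
      have e : insert c (B \ C) = B ∩ (C \ {c})ᶜ := by
        ext z
        simp only [Set.mem_insert_iff, Set.mem_sdiff, Set.mem_inter_iff, Set.mem_compl_iff,
          Set.mem_singleton_iff]
        constructor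
        · rintro (rfl | h)
          · exact ⟨hcB, fun k => k.2 rfl⟩
          · exact ⟨h.1, fun k => h.2 k.1⟩
        · rintro ⟨h1, h2⟩
          by_cases hz : z = c
          · exact Or.inl hz
          · exact Or.inr ⟨h1, fun k => h2 ⟨k, hz⟩⟩
      rw [e]
      refine IsCut.inter hG hB (hCsub _ Set.sdiff_subset).compl ⟨c', ?_⟩
      simp only [Set.mem_compl_iff, Set.mem_union, not_or, not_not, Set.mem_sdiff,
        Set.mem_singleton_iff]
      exact ⟨hc'B, hc'C, fun k => hc'B (k ▸ hcB)⟩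
    have hnt : (B \ C).Nontrivial := by
      by_contra k
      rw [Set.not_nontrivial_iff] at k
      have e : B \ C = {b} := by
        ext z
        exact ⟨fun hz => k hz ⟨hbB, hbC⟩, fun hz => by rw [hz]; exact ⟨hbB, hbC⟩⟩
      rw [e, Set.pair_comm] at hcut2
      exact hbC (hCclosed c hcC b (fun k => hbC (k ▸ hcC)) hcut2)
    obtain ⟨D, hD, hDc⟩ : ∃ D, G.IsCut D ∧ c ∈ D ∧ ((B \ C) ∩ D).Nonempty ∧
        ((B \ C) ∩ Dᶜ).Nonempty ∧ ((B \ C)ᶜ ∩ Dᶜ).Nonempty := by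
      obtain ⟨D, hD, h1, h2, h3, h4⟩ := hc (B \ C)
        ⟨hnt, hCnt.mono fun z hz k => k.2 hz, hcut1⟩
      by_cases hcD : c ∈ D
      · exact ⟨D, hD.2.2, hcD, h1, h3, h4⟩
      · refine ⟨Dᶜ, IsCut.compl hD.2.2, hcD, h3, ?_, ?_⟩ <;> rwa [compl_compl]
    obtain ⟨hcD, ⟨x, hx, hxD⟩, ⟨y, hy, hyD⟩, ⟨z, hz, hzD⟩⟩ := hDc
    have hX : G.IsCut (insert c (B \ C) ∩ D) := by
      refine IsCut.inter hG hcut2 hD ⟨z, ?_⟩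
      simp only [Set.mem_compl_iff, Set.mem_union, not_or, Set.mem_insert_iff]
      exact ⟨⟨fun k => hzD (k ▸ hcD), hz⟩, hzD⟩
    refine hBmin (insert c (B \ C) ∩ D) ⟨hX, ⟨c, hcC, Or.inl rfl, hcD⟩, ⟨x, hx.2, Or.inr hx, hxD⟩,
      ⟨c', hc'C, ?_⟩, ⟨y, hy.2, fun k => hyD k.2⟩⟩ ?_
    · rintro ⟨k | k, -⟩
      · exact hc'B (k ▸ hcB)
      · exact k.2 hc'C
    · refine Set.ncard_lt_ncard ⟨?_, fun k => hyD (k hy).1.2⟩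
      rintro w ⟨⟨rfl | hw, -⟩, hwC⟩
      · exact absurd hcC hwC
      · exact hw
  intro A
  by_cases hAC : A ⊆ C
  · exact hCsub A hAC
  · rw [← isCut_compl_iff]
    apply hCsub
    obtain ⟨x, hxA, hxC⟩ := Set.not_subset.1 hAC
    intro y hy
    by_contra hyC
    exact hy (hCs hyC hxC ▸ hxA)

end Prime

end SimpleGraph

namespace SimpleGraph

/-! ### Directions in a tree. -/

section Tree

variable {N : Type*} {T : SimpleGraph N}

/-- The set of nodes on the side of `u` after deletion of the edge `tu`. -/
def side (T : SimpleGraph N) (t u : N) : Set N :=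
  {x | (T.deleteEdges {s(t, u)}).Reachable u x}

open Classical in
/-- The second vertex of a path from `t` to `x` (and `t` itself if `x = t`). -/
noncomputable def toward (T : SimpleGraph N) (t x : N) : N :=
  if h : ∃ p : T.Walk t x, p.IsPath then h.choose.snd else t

theorem IsTree.toward_cons (hT : T.IsTree) {t u x : N} (h : T.Adj t u) (p : T.Walk u x)
    (hp : (Walk.cons h p).IsPath) : T.toward t x = u := by
  have hex : ∃ p : T.Walk t x, p.IsPath := ⟨_, hp⟩
  rw [toward, dif_pos hex]
  have := (hT.isAcyclic.subsingleton_path _ _).elim ⟨hex.choose, hex.choose_spec⟩ ⟨_, hp⟩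
  rw [show hex.choose = Walk.cons h p from congrArg Subtype.val this]
  simp

theorem IsTree.exists_cons (hT : T.IsTree) {t x : N} (h : x ≠ t) :
    ∃ (ha : T.Adj t (T.toward t x)) (p : T.Walk (T.toward t x) x), (Walk.cons ha p).IsPath := by
  obtain ⟨p, hp⟩ := hT.connected.exists_isPath t x
  cases p with
  | nil => exact absurd rfl h
  | cons ha p =>
    have := hT.toward_cons ha p hp
    subst this
    exact ⟨ha, p, hp⟩

theorem IsTree.adj_toward (hT : T.IsTree) {t x : N} (h : x ≠ t) : T.Adj t (T.toward t x) :=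
  (hT.exists_cons h).1

theorem IsTree.toward_of_adj (hT : T.IsTree) {t u : N} (h : T.Adj t u) : T.toward t u = u :=
  hT.toward_cons h .nil (by simp [h.ne])

theorem IsTree.mem_side_iff (hT : T.IsTree) {t u x : N} (h : T.Adj t u) :
    x ∈ T.side t u ↔ x ≠ t ∧ T.toward t x = u := by
  constructor
  · intro hx
    have hb : ¬ (T.deleteEdges {s(t, u)}).Reachable t u := by
      have := isAcyclic_iff_forall_adj_isBridge.1 hT.isAcyclic h
      simpa [isBridge_iff] using this
    obtain ⟨q, hq⟩ := Reachable.exists_isPath hx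
    have hle : T.deleteEdges {s(t, u)} ≤ T := deleteEdges_le _
    have ht : t ∉ q.support := by
      classical
      intro ht
      exact hb ⟨(q.takeUntil t ht).reverse⟩
    have hp : (Walk.cons h (q.mapLe hle)).IsPath := by
      rw [Walk.cons_isPath_iff]
      exact ⟨(Walk.isPath_mapLe hle).2 hq, by simpa using ht⟩
    refine ⟨?_, hT.toward_cons h _ hp⟩
    rintro rfl
    exact ht q.end_mem_support
  · rintro ⟨hx, rfl⟩
    obtain ⟨ha, p, hp⟩ := hT.exists_cons hx
    rw [Walk.cons_isPath_iff] at hp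
    refine ⟨p.toDeleteEdges _ ?_⟩
    rintro e he rfl
    exact hp.2 (p.fst_mem_support_of_mem_edges he)

theorem IsTree.toward_eq_of_adj (hT : T.IsTree) {t x y : N} (h : T.Adj x y) (hx : x ≠ t)
    (hy : y ≠ t) : T.toward t x = T.toward t y := by
  have h1 := (hT.mem_side_iff (hT.adj_toward hx)).2 ⟨hx, rfl⟩
  have h2 : y ∈ T.side t (T.toward t x) := by
    refine Reachable.trans h1 (Adj.reachable ?_)
    rw [deleteEdges_adj]
    refine ⟨h, ?_⟩
    simp only [Set.mem_singleton_iff, Sym2.eq_iff]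
    tauto
  exact ((hT.mem_side_iff (hT.adj_toward hx)).1 h2).2.symm

theorem IsTree.toward_eq_of_walk (hT : T.IsTree) {t x y : N} (p : T.Walk x y)
    (hp : t ∉ p.support) : T.toward t x = T.toward t y := by
  induction p with
  | nil => rfl
  | cons h q ih =>
    rw [Walk.support_cons, List.mem_cons, not_or] at hp
    rw [hT.toward_eq_of_adj h (Ne.symm hp.1) (fun k => hp.2 (k ▸ q.start_mem_support)), ih hp.2]

theorem IsTree.toward_eq_of_mem_support (hT : T.IsTree) {t u x y : N} (h : T.Adj t u)
    (p : T.Walk u x) (hp : (Walk.cons h p).IsPath) (hy : y ∈ p.support) : T.toward t y = u := by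
  classical
  rw [Walk.cons_isPath_iff] at hp
  refine hT.toward_cons h (p.takeUntil y hy) ?_
  rw [Walk.cons_isPath_iff]
  exact ⟨hp.1.takeUntil hy, fun k => hp.2 (p.support_takeUntil_subset_support hy k)⟩

/-- If `x` and `t` lie in different directions from `s`, then `x` and `s` lie in the same direction
from `t`. -/
theorem IsTree.toward_eq_of_toward_ne (hT : T.IsTree) {t s x : N} (hts : t ≠ s) (hx : x ≠ s)
    (h : T.toward s x ≠ T.toward s t) : T.toward t x = T.toward t s := by
  obtain ⟨ha, p, hp⟩ := hT.exists_cons hx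
  refine (hT.toward_eq_of_walk (.cons ha p) ?_).symm
  rw [Walk.support_cons, List.mem_cons, not_or]
  exact ⟨hts, fun k => h (hT.toward_eq_of_mem_support ha p hp k).symm⟩

theorem ne_of_toward_ne {t s x : N}
    (h : T.toward s x ≠ T.toward s t) : x ≠ t := fun k => h (k ▸ rfl)

/-- For an edge `tu`, every node lies on exactly one side. -/
theorem IsTree.mem_side_comm (hT : T.IsTree) {t u x : N} (h : T.Adj t u) :
    (x ≠ t ∧ T.toward t x = u) ↔ ¬ (x ≠ u ∧ T.toward u x = t) := by
  constructor
  · rintro ⟨h1, h2⟩ ⟨h3, h4⟩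
    obtain ⟨ha, p, hp⟩ := hT.exists_cons h1
    obtain ⟨hb, q, hq⟩ := hT.exists_cons h3
    subst h2
    generalize T.toward t x = u at *
    subst h4
    rw [Walk.cons_isPath_iff] at hp
    have : (⟨_, hp.1⟩ : T.Path _ _) = ⟨_, hq⟩ := (hT.isAcyclic.subsingleton_path _ _).elim _ _
    have : p = Walk.cons hb q := congrArg Subtype.val this
    apply hp.2
    rw [this, Walk.support_cons]
    exact List.mem_cons_of_mem _ q.start_mem_support
  · intro hn
    by_cases hxu : x = u
    · subst hxu
      exact ⟨h.ne', hT.toward_of_adj h⟩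
    have h1 : T.toward u x ≠ t := fun k => hn ⟨hxu, k⟩
    have h2 : T.toward u x ≠ T.toward u t := by rwa [hT.toward_of_adj h.symm]
    exact ⟨ne_of_toward_ne h2, by rw [hT.toward_eq_of_toward_ne h.ne hxu h2, hT.toward_of_adj h]⟩

end Tree

end SimpleGraph

open SimpleGraph

/-! ### Reading adjacency and pointing at a node of the tree. -/

namespace CanonicalSplitDecomposition

variable {V N : Type*} {G : SimpleGraph V} (D : CanonicalSplitDecomposition G N)

/-- The neighbour of `t` in the direction of the leaf of `v`. -/
noncomputable def br (t : N) (v : V) : N := D.T.toward t (D.leaf v)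

/-- The vertex `v` has a neighbour outside its branch at `t`. -/
def Active (t : N) (v : V) : Prop := ∃ w, D.br t w ≠ D.br t v ∧ G.Adj v w

/-- The internal node `t` is labelled by a star with centre mapped to the edge `tc`. -/
def StarAt (t c : N) : Prop :=
  D.IsInternal t ∧ D.T.Adj t c ∧ ∀ u w, D.T.Adj t u → D.T.Adj t w →
    (G.Adj (D.rep t u) (D.rep t w) ↔ u ≠ w ∧ (u = c ∨ w = c))

variable {D}

theorem IsInternal.leaf_ne {t : N} (ht : D.IsInternal t) (v : V) : D.leaf v ≠ t :=
  fun h => ht ⟨v, h⟩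

theorem IsInternal.adj_br {t : N} (ht : D.IsInternal t) (v : V) : D.T.Adj t (D.br t v) :=
  D.isTree.adj_toward (ht.leaf_ne v)

theorem IsInternal.mem_branchAt_iff {t u : N} (ht : D.IsInternal t) (h : D.T.Adj t u) (v : V) :
    v ∈ branchAt D.T D.leaf t u ↔ D.br t v = u :=
  (D.isTree.mem_side_iff (x := D.leaf v) h).trans (by simp [ht.leaf_ne v, br])

theorem IsInternal.br_rep {t u : N} (ht : D.IsInternal t) (h : D.T.Adj t u) :
    D.br t (D.rep t u) = u :=
  (ht.mem_branchAt_iff h _).1 (D.rep_mem t u ht h)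

theorem IsInternal.active_rep {t u : N} (ht : D.IsInternal t) (h : D.T.Adj t u) :
    D.Active t (D.rep t u) := by
  obtain ⟨w, hw, hw'⟩ := D.rep_adj t u ht h
  rw [ht.mem_branchAt_iff h] at hw
  exact ⟨w, by rwa [ht.br_rep h], hw'⟩

theorem leaf_adj_unique {v : V} {a b : N} (ha : D.T.Adj (D.leaf v) a)
    (hb : D.T.Adj (D.leaf v) b) : a = b := by
  have h : D.leaf v ∈ {t | (D.T.neighborSet t).ncard = 1} := D.range_leaf ▸ ⟨v, rfl⟩
  obtain ⟨x, hx⟩ := Set.ncard_eq_one.1 h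
  have h1 : a ∈ D.T.neighborSet (D.leaf v) := ha
  have h2 : b ∈ D.T.neighborSet (D.leaf v) := hb
  rw [hx] at h1 h2
  exact h1.trans h2.symm

theorem isInternal_of_adj {t a b : N} (ha : D.T.Adj t a) (hb : D.T.Adj t b) (hab : a ≠ b) :
    D.IsInternal t := by
  rintro ⟨v, rfl⟩
  exact hab (leaf_adj_unique ha hb)

theorem IsInternal.exists_adj_ne_ne {t : N} (ht : D.IsInternal t) (a b : N) :
    ∃ u, D.T.Adj t u ∧ u ≠ a ∧ u ≠ b := by
  have := D.finite
  by_contra hc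
  have hsub : D.T.neighborSet t ⊆ {a, b} := by
    intro u hu
    by_contra hn
    simp only [Set.mem_insert_iff, Set.mem_singleton_iff, not_or] at hn
    exact hc ⟨u, hu, hn⟩
  have h1 := Set.ncard_le_ncard hsub (Set.toFinite _)
  have h2 := D.three_le_degree t ht
  have h3 : ({a, b} : Set N).ncard ≤ 2 := (Set.ncard_insert_le a {b}).trans (by simp)
  omega

theorem leaf_eq_of_toward_eq {t : N} {v w : V} (h : D.T.Adj t (D.leaf w)) (hv : D.leaf v ≠ t)
    (hb : D.T.toward t (D.leaf v) = D.leaf w) : v = w := by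
  by_contra hne
  have hl : D.leaf v ≠ D.leaf w := fun k => hne (D.leaf_injective k)
  exact (D.isTree.mem_side_comm h).1 ⟨hv, hb⟩
    ⟨hl, leaf_adj_unique (D.isTree.adj_toward hl) h.symm⟩

theorem br_eq_iff {t u : N} (ht : D.IsInternal t) (hu : D.IsInternal u) (h : D.T.Adj t u) (v : V) :
    D.br t v = u ↔ D.br u v ≠ t := by
  have := D.isTree.mem_side_comm (x := D.leaf v) h
  simpa [ht.leaf_ne v, hu.leaf_ne v, br] using this

/-- Edges between internal nodes give strong splits, and edges to leaves give singletons. -/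
theorem IsInternal.isCut_branch {t u : N} (ht : D.IsInternal t) (h : D.T.Adj t u) :
    G.IsCut {v | D.br t v = u} := by
  by_cases hu : D.IsInternal u
  · have := ((D.isStrongSplit_iff _).2 ⟨t, u, ht, hu, h, rfl⟩).1.2.2
    have e : branchAt D.T D.leaf t u = {v | D.br t v = u} :=
      Set.ext fun v => ht.mem_branchAt_iff h v
    rwa [e] at this
  · rw [IsInternal, not_not] at hu
    obtain ⟨w, rfl⟩ := hu
    refine isCut_of_subsingleton fun x hx y hy => ?_
    rw [leaf_eq_of_toward_eq h (ht.leaf_ne x) hx, leaf_eq_of_toward_eq h (ht.leaf_ne y) hy]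

theorem IsInternal.adj_of_active {t : N} (ht : D.IsInternal t) {v w : V} (hv : D.Active t v)
    (hw : ∃ z, D.br t z = D.br t v ∧ G.Adj w z) (h : D.br t w ≠ D.br t v) : G.Adj v w := by
  obtain ⟨z, hz, hwz⟩ := hw
  obtain ⟨y, hy, hvy⟩ := hv
  exact ht.isCut_branch (ht.adj_br v) v rfl w h ⟨y, hy, hvy⟩ ⟨z, hz, hwz⟩

/-- The fundamental reading rule at a node: the cut conditions of the two branches allow each vertex
to be exchanged for the representative of its branch. -/
theorem IsInternal.adj_iff {t : N} (ht : D.IsInternal t) {v w : V} (h : D.br t v ≠ D.br t w) :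
    G.Adj v w ↔ D.Active t v ∧ D.Active t w ∧
      G.Adj (D.rep t (D.br t v)) (D.rep t (D.br t w)) := by
  have hv := ht.br_rep (ht.adj_br v)
  have hw := ht.br_rep (ht.adj_br w)
  have av := ht.active_rep (ht.adj_br v)
  have aw := ht.active_rep (ht.adj_br w)
  constructor
  · intro hvw
    refine ⟨⟨w, h.symm, hvw⟩, ⟨v, h, hvw.symm⟩, ?_⟩
    have h1 : G.Adj (D.rep t (D.br t v)) w :=
      ht.adj_of_active av ⟨v, hv.symm, hvw.symm⟩ (by rw [hv]; exact h.symm)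
    exact (ht.adj_of_active aw ⟨w, hw.symm, h1⟩ (by rw [hv, hw]; exact h)).symm
  · rintro ⟨a1, a2, hr⟩
    have h1 : G.Adj v (D.rep t (D.br t w)) :=
      ht.adj_of_active a1 ⟨_, hv, hr.symm⟩ (by rw [hw]; exact h.symm)
    exact (ht.adj_of_active a2 ⟨_, hw, h1⟩ h).symm

theorem isStarNodeWithCenter_iff {t c : N} (h : D.T.Adj t c) :
    D.IsStarNodeWithCenter t ⟨c, h⟩ ↔ D.StarAt t c := by
  constructor
  · rintro ⟨ht, hs⟩
    refine ⟨ht, h, fun u w hu hw => ?_⟩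
    exact (hs ⟨u, hu⟩ ⟨w, hw⟩).trans (and_congr (not_congr Subtype.ext_iff)
      (or_congr Subtype.ext_iff Subtype.ext_iff))
  · rintro ⟨ht, -, hs⟩
    refine ⟨ht, ?_⟩
    rintro ⟨u, hu⟩ ⟨w, hw⟩
    have e : ∀ {a b : N} (ha : D.T.Adj t a) (hb : D.T.Adj t b),
        a = b ↔ (⟨a, ha⟩ : D.T.neighborSet t) = ⟨b, hb⟩ :=
      fun _ _ => ⟨fun k => Subtype.ext k, fun k => congrArg Subtype.val k⟩
    exact (hs u w hu hw).trans (and_congr (not_congr (e hu hw)) (or_congr (e hu h) (e hw h)))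

theorem isStarNode_iff {t : N} : D.IsStarNode t ↔ ∃ c, D.StarAt t c := by
  constructor
  · rintro ⟨⟨c, hc⟩, h⟩
    exact ⟨c, (isStarNodeWithCenter_iff hc).1 h⟩
  · rintro ⟨c, h⟩
    exact ⟨⟨c, h.2.1⟩, (isStarNodeWithCenter_iff h.2.1).2 h⟩

theorem isCliqueNode_iff {t : N} : D.IsCliqueNode t ↔ D.IsInternal t ∧
    ∀ u w, D.T.Adj t u → D.T.Adj t w → u ≠ w → G.Adj (D.rep t u) (D.rep t w) := by
  refine and_congr_right fun ht => ⟨fun h u w hu hw huw => ?_, fun h => ?_⟩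
  · have : (D.label t).Adj ⟨u, hu⟩ ⟨w, hw⟩ := by
      rw [h]
      exact fun k => huw (congrArg Subtype.val k)
    exact this
  · ext ⟨u, hu⟩ ⟨w, hw⟩
    refine ⟨fun k => k.ne, fun k => h u w hu hw fun k' => k (Subtype.ext k')⟩

theorem StarAt.center_unique {t c c' : N} (h : D.StarAt t c) (h' : D.StarAt t c') : c = c' := by
  by_contra hne
  obtain ⟨u, hu, h1, h2⟩ := h.1.exists_adj_ne_ne c c'
  have := (h.2.2 u c hu h.2.1).2 ⟨h1, Or.inr rfl⟩
  rcases ((h'.2.2 u c hu h.2.1).1 this).2 with k | k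
  · exact h2 k
  · exact hne k

theorem StarAt.not_isCliqueNode {t c : N} (h : D.StarAt t c) : ¬ D.IsCliqueNode t := by
  intro hk
  rw [isCliqueNode_iff] at hk
  obtain ⟨u, hu, h1, -⟩ := h.1.exists_adj_ne_ne c c
  obtain ⟨w, hw, h2, h3⟩ := h.1.exists_adj_ne_ne c u
  rcases ((h.2.2 u w hu hw).1 (hk.2 u w hu hw h3.symm)).2 with k | k
  · exact h1 k
  · exact h2 k

theorem mem_edges_of_isPath {t x : N} (hx : x ≠ t) (p : D.T.Walk t x) (hp : p.IsPath) :
    s(t, D.T.toward t x) ∈ p.edges := by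
  cases p with
  | nil => exact absurd rfl hx
  | cons h q =>
    rw [D.isTree.toward_cons h q hp]
    simp

theorem isPath_mem_edges_iff {t c x : N} (hx : x ≠ t) :
    (∃ p : D.T.Walk t x, p.IsPath ∧ s(t, c) ∈ p.edges) ↔ D.T.toward t x = c := by
  constructor
  · rintro ⟨p, hp, hc⟩
    cases p with
    | nil => exact absurd rfl hx
    | cons h q =>
      rw [D.isTree.toward_cons h q hp]
      rw [Walk.edges_cons, List.mem_cons] at hc
      rcases hc with hc | hc
      · rcases Sym2.eq_iff.1 hc with ⟨-, k⟩ | ⟨k, -⟩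
        · exact k.symm
        · exact absurd k h.ne
      · rw [Walk.cons_isPath_iff] at hp
        exact absurd (q.fst_mem_support_of_mem_edges hc) hp.2
  · rintro rfl
    obtain ⟨p, hp⟩ := D.isTree.connected.exists_isPath t x
    exact ⟨p, hp, mem_edges_of_isPath hx p hp⟩

theorem StarAt.pointsTowardNode_iff {t c x : N} (h : D.StarAt t c) :
    D.PointsTowardNode t x ↔ x ≠ t ∧ D.T.toward t x = c := by
  constructor
  · rintro ⟨⟨c', hc'⟩, hs, hp⟩
    have := ((isStarNodeWithCenter_iff hc').1 hs).center_unique h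
    subst this
    have hx : x ≠ t := by
      rintro rfl
      obtain ⟨p, hp, he⟩ := hp
      cases p with
      | nil => simp at he
      | cons hb q =>
        rw [Walk.cons_isPath_iff] at hp
        exact hp.2 q.end_mem_support
    exact ⟨hx, (isPath_mem_edges_iff hx).1 hp⟩
  · rintro ⟨hx, hc⟩
    exact ⟨⟨c, h.2.1⟩, (isStarNodeWithCenter_iff h.2.1).2 h, (isPath_mem_edges_iff hx).2 hc⟩

end CanonicalSplitDecomposition

/-! ### Contracting a tree edge: the decomposition is reduced. -/

namespace SimpleGraph

theorem isCut_preimage_of_complete {V I : Type*} {G : SimpleGraph V} (f : V → I)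
    (h : ∀ v w, f v ≠ f w → (∃ z, f z ≠ f v ∧ G.Adj v z) → (∃ z, f z ≠ f w ∧ G.Adj w z) →
      G.Adj v w) (J : Set I) : G.IsCut (f ⁻¹' J) := by
  rintro x hx y hy ⟨y', hy', hxy'⟩ ⟨x', hx', hyx'⟩
  have ne : ∀ {x y}, x ∈ f ⁻¹' J → y ∈ (f ⁻¹' J)ᶜ → f x ≠ f y := fun hx hy k =>
    hy (show _ ∈ J from k ▸ hx)
  exact h x y (ne hx hy) ⟨y', (ne hx hy').symm, hxy'⟩ ⟨x', ne hx' hy, hyx'⟩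

theorem isCut_preimage_of_star {V I : Type*} {G : SimpleGraph V} (f : V → I) (c : I)
    (h : ∀ v w, f v ≠ f w → G.Adj v w → f v = c ∨ f w = c)
    (h' : ∀ v w, f v = c → f w ≠ c → (∃ z, f z ≠ f v ∧ G.Adj v z) →
      (∃ z, f z ≠ f w ∧ G.Adj w z) → G.Adj v w) (J : Set I) : G.IsCut (f ⁻¹' J) := by
  rintro x hx y hy ⟨y', hy', hxy'⟩ ⟨x', hx', hyx'⟩
  have ne : ∀ {x y}, x ∈ f ⁻¹' J → y ∈ (f ⁻¹' J)ᶜ → f x ≠ f y := fun hx hy k =>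
    hy (show _ ∈ J from k ▸ hx)
  have ax : ∃ z, f z ≠ f x ∧ G.Adj x z := ⟨y', (ne hx hy').symm, hxy'⟩
  have ay : ∃ z, f z ≠ f y ∧ G.Adj y z := ⟨x', ne hx' hy, hyx'⟩
  rcases h x y' (ne hx hy') hxy' with k | k
  · exact h' x y k (fun k' => ne hx hy (k.trans k'.symm)) ax ay
  · have ky : f y = c := (h y x' (ne hx' hy).symm hyx').resolve_right
      fun k' => ne hx' hy' (k'.trans k.symm)
    exact (h' y x ky (fun k' => ne hx hy (k'.trans ky.symm)) ay ax).symm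

end SimpleGraph

namespace CanonicalSplitDecomposition

variable {V N : Type*} {G : SimpleGraph V} {D : CanonicalSplitDecomposition G N}

open Classical in
/-- The branches at the node obtained by contracting the edge `tu` of the decomposition tree. -/
noncomputable def mergedBr (D : CanonicalSplitDecomposition G N) (t u : N) (v : V) : N :=
  if D.br t v = u then D.br u v else D.br t v

theorem ne_of_adj_of_adj {t u a b : N} (h : D.T.Adj t u) (ha : D.T.Adj t a) (hau : a ≠ u)
    (hb : D.T.Adj u b) : a ≠ b := by
  rintro rfl
  have := D.isTree.toward_eq_of_adj hb h.ne' ha.ne'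
  rw [D.isTree.toward_of_adj ha, D.isTree.toward_of_adj h] at this
  exact hau this.symm

theorem mergedBr_comm {t u : N} (ht : D.IsInternal t) (hu : D.IsInternal u)
    (h : D.T.Adj t u) : D.mergedBr t u = D.mergedBr u t := by
  funext v
  have := br_eq_iff ht hu h v
  by_cases k : D.br t v = u
  · rw [mergedBr, if_pos k, mergedBr, if_neg (this.1 k)]
  · rw [mergedBr, if_neg k, mergedBr, if_pos (by_contra fun k' => k (this.2 k'))]

theorem active_of_mergedBr {t u : N} {v : V} (hv : D.br t v ≠ u)
    (ha : ∃ z, D.mergedBr t u z ≠ D.mergedBr t u v ∧ G.Adj v z) : D.Active t v := by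
  obtain ⟨z, hz, hvz⟩ := ha
  refine ⟨z, fun k => hz ?_, hvz⟩
  rw [mergedBr, if_neg (k ▸ hv), mergedBr, if_neg hv, k]

theorem active_of_adj_rep {t u : N} (ht : D.IsInternal t) (hu : D.IsInternal u)
    (h : D.T.Adj t u) {v : V} (hv : D.br t v ≠ u) (ha : D.Active t v)
    (hr : G.Adj (D.rep t (D.br t v)) (D.rep t u)) : D.Active u v := by
  have hbr := ht.br_rep h
  have h1 : G.Adj v (D.rep t u) := by
    rw [ht.adj_iff (by rwa [hbr]), hbr]
    exact ⟨ha, ht.active_rep h, hr⟩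
  refine ⟨_, ?_, h1⟩
  have e1 := (br_eq_iff ht hu h _).1 hbr
  have e2 : D.br u v = t := by_contra fun k => hv ((br_eq_iff ht hu h v).2 k)
  rwa [e2]

/-- Contracting an internal edge of the decomposition tree gives a node with a union of branches
violating the adjacency condition of a split. -/
theorem not_forall_isCut_mergedBr {t u : N} (ht : D.IsInternal t) (hu : D.IsInternal u)
    (h : D.T.Adj t u) (hall : ∀ J, G.IsCut (D.mergedBr t u ⁻¹' J)) : False := by
  -- Joining a branch `a` at `t` with a branch `b` at `u`, and leaving out `a'` and `b'`, gives a
  -- split that crosses the strong split of the edge `tu`.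
  obtain ⟨a, ha, hau, -⟩ := ht.exists_adj_ne_ne u u
  obtain ⟨a', ha', ha'u, ha'a⟩ := ht.exists_adj_ne_ne u a
  obtain ⟨b, hb, hbt, -⟩ := hu.exists_adj_ne_ne t t
  obtain ⟨b', hb', hb't, hb'b⟩ := hu.exists_adj_ne_ne t b
  have f1 : ∀ x, D.T.Adj t x → x ≠ u → D.mergedBr t u (D.rep t x) = x := by
    intro x hx hxu
    rw [mergedBr, if_neg (by rwa [ht.br_rep hx]), ht.br_rep hx]
  have f2 : ∀ x, D.T.Adj u x → x ≠ t → D.mergedBr t u (D.rep u x) = x := by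
    intro x hx hxu
    rw [mergedBr_comm ht hu h, mergedBr, if_neg (by rwa [hu.br_rep hx]), hu.br_rep hx]
  have g2 : ∀ x, D.T.Adj u x → x ≠ t → D.br t (D.rep u x) = u := by
    intro x hx hxt
    rw [br_eq_iff ht hu h, hu.br_rep hx]
    exact hxt
  have hstr : IsStrongSplit G (branchAt D.T D.leaf t u) :=
    (D.isStrongSplit_iff _).2 ⟨t, u, ht, hu, h, rfl⟩
  have m := ht.mem_branchAt_iff h
  have k1 : a ≠ b' := ne_of_adj_of_adj h ha hau hb'
  have k2 : a' ≠ b := ne_of_adj_of_adj h ha' ha'u hb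
  have p1 : D.rep t a ∈ D.mergedBr t u ⁻¹' {a, b} := by simp [f1 a ha hau]
  have p2 : D.rep u b ∈ D.mergedBr t u ⁻¹' {a, b} := by simp [f2 b hb hbt]
  have p3 : D.rep t a' ∈ (D.mergedBr t u ⁻¹' {a, b})ᶜ := by simp [f1 a' ha' ha'u, ha'a, k2]
  have p4 : D.rep u b' ∈ (D.mergedBr t u ⁻¹' {a, b})ᶜ := by simp [f2 b' hb' hb't, hb'b, k1.symm]
  have q1 : D.rep t a ∈ (branchAt D.T D.leaf t u)ᶜ := by
    rw [Set.mem_compl_iff, m, ht.br_rep ha]; exact hau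
  have q2 : D.rep u b ∈ branchAt D.T D.leaf t u := (m _).2 (g2 b hb hbt)
  have q3 : D.rep t a' ∈ (branchAt D.T D.leaf t u)ᶜ := by
    rw [Set.mem_compl_iff, m, ht.br_rep ha']; exact ha'u
  have q4 : D.rep u b' ∈ branchAt D.T D.leaf t u := (m _).2 (g2 b' hb' hb't)
  have hs : IsSplit G (D.mergedBr t u ⁻¹' {a, b}) :=
    ⟨⟨_, p1, _, p2, fun k => q1 (k ▸ q2)⟩, ⟨_, p3, _, p4, fun k => q3 (k ▸ q4)⟩, hall _⟩
  rcases hstr.2 _ hs with e | e | e | e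
  · exact Set.eq_empty_iff_forall_notMem.1 e _ ⟨q2, p2⟩
  · exact Set.eq_empty_iff_forall_notMem.1 e _ ⟨q1, p1⟩
  · exact Set.eq_empty_iff_forall_notMem.1 e _ ⟨q4, p4⟩
  · exact Set.eq_empty_iff_forall_notMem.1 e _ ⟨q3, p3⟩

/-- Contracting the edge would give a clique node again, and every union of branches at a clique
node is a cut. -/
theorem not_isCliqueNode_of_adj {t u : N} (h : D.T.Adj t u) (ht : D.IsCliqueNode t) :
    ¬ D.IsCliqueNode u := by
  intro hu
  rw [isCliqueNode_iff] at ht hu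
  obtain ⟨ht, kt⟩ := ht
  obtain ⟨hu, ku⟩ := hu
  have key : ∀ {t u : N}, D.IsInternal t → D.IsInternal u → D.T.Adj t u →
      (∀ a b, D.T.Adj t a → D.T.Adj t b → a ≠ b → G.Adj (D.rep t a) (D.rep t b)) →
      (∀ a b, D.T.Adj u a → D.T.Adj u b → a ≠ b → G.Adj (D.rep u a) (D.rep u b)) →
      ∀ v w, D.br t v ≠ u → D.mergedBr t u v ≠ D.mergedBr t u w →
        (∃ z, D.mergedBr t u z ≠ D.mergedBr t u v ∧ G.Adj v z) →
        (∃ z, D.mergedBr t u z ≠ D.mergedBr t u w ∧ G.Adj w z) → G.Adj v w := by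
    intro t u ht hu h kt ku v w hv hvw av aw
    have av' := active_of_mergedBr hv av
    by_cases hw : D.br t w = u
    · have hw' := (br_eq_iff ht hu h w).1 hw
      rw [mergedBr_comm ht hu h] at aw
      have aw' := active_of_adj_rep hu ht h.symm hw' (active_of_mergedBr hw' aw)
        (ku _ _ (hu.adj_br w) h.symm hw')
      have hne : D.br t v ≠ D.br t w := by rwa [hw]
      exact (ht.adj_iff hne).2 ⟨av', aw', kt _ _ (ht.adj_br v) (ht.adj_br w) hne⟩
    · have aw' := active_of_mergedBr hw aw
      rw [mergedBr, if_neg hv, mergedBr, if_neg hw] at hvw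
      exact (ht.adj_iff hvw).2 ⟨av', aw', kt _ _ (ht.adj_br v) (ht.adj_br w) hvw⟩
  refine not_forall_isCut_mergedBr ht hu h (isCut_preimage_of_complete _ ?_)
  intro v w hvw av aw
  by_cases hv : D.br t v = u
  · rw [mergedBr_comm ht hu h] at hvw av aw
    exact key hu ht h.symm ku kt v w ((br_eq_iff ht hu h v).1 hv) hvw av aw
  · exact key ht hu h kt ku v w hv hvw av aw

/-- If the star at `t` points towards an adjacent star node `u`, then the star at `u` points
towards `t`. -/
theorem StarAt.center_eq_of_adj {t u c : N} (ht : D.StarAt t u) (hu : D.StarAt u c) : c = t := by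
  by_contra hc
  have h := ht.2.1
  have it := ht.1
  have iu := hu.1
  -- If `c` is not `t`, the contracted node is again a star with centre `c`, and every union of its
  -- branches is a cut.
  refine not_forall_isCut_mergedBr it iu h (isCut_preimage_of_star _ c ?_ ?_)
  · have aux : ∀ v w, D.mergedBr t u v ≠ D.mergedBr t u w → G.Adj v w → D.br t v ≠ u →
        D.mergedBr t u w = c := by
      intro v w hvw hadj hv
      by_cases hw : D.br t w = u
      · have h1 : D.br u v = t := by_contra fun k => hv ((br_eq_iff it iu h v).2 k)
        have h2 := (br_eq_iff it iu h w).1 hw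
        rw [mergedBr, if_pos hw]
        have h3 := ((iu.adj_iff (by rw [h1]; exact h2.symm)).1 hadj).2.2
        exact ((hu.2.2 _ _ (iu.adj_br v) (iu.adj_br w)).1 h3).2.resolve_left
          (by rw [h1]; exact Ne.symm hc)
      · rw [mergedBr, if_neg hv, mergedBr, if_neg hw] at hvw
        have h3 := ((it.adj_iff hvw).1 hadj).2.2
        rcases ((ht.2.2 _ _ (it.adj_br v) (it.adj_br w)).1 h3).2 with k | k
        · exact absurd k hv
        · exact absurd k hw
    intro v w hvw hadj
    by_cases hv : D.br t v = u
    · by_cases hw : D.br t w = u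
      · rw [mergedBr, if_pos hv, mergedBr, if_pos hw] at hvw ⊢
        have h3 := ((iu.adj_iff hvw).1 hadj).2.2
        exact ((hu.2.2 _ _ (iu.adj_br v) (iu.adj_br w)).1 h3).2
      · exact Or.inl (aux w v hvw.symm hadj.symm hw)
    · exact Or.inr (aux v w hvw hadj hv)
  · intro v w hv hw av aw
    have hvu : D.br t v = u := by
      by_contra k
      rw [mergedBr, if_neg k] at hv
      exact ne_of_adj_of_adj h (it.adj_br v) k hu.2.1 hv
    have hvt := (br_eq_iff it iu h v).1 hvu
    have hv' : D.br u v = c := by rwa [mergedBr, if_pos hvu] at hv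
    have av' : D.Active u v := by
      rw [mergedBr_comm it iu h] at av
      exact active_of_mergedBr hvt av
    have hwc : D.br u w ≠ c ∧ D.Active u w := by
      by_cases hwu : D.br t w = u
      · rw [mergedBr_comm it iu h] at aw
        refine ⟨by rwa [mergedBr, if_pos hwu] at hw, ?_⟩
        exact active_of_mergedBr ((br_eq_iff it iu h w).1 hwu) aw
      · have h1 : D.br u w = t := by_contra fun k => hwu ((br_eq_iff it iu h w).2 k)
        refine ⟨by rw [h1]; exact Ne.symm hc, ?_⟩
        exact active_of_adj_rep it iu h hwu (active_of_mergedBr hwu aw)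
          ((ht.2.2 _ _ (it.adj_br w) h).2 ⟨hwu, Or.inr rfl⟩)
    have hne : D.br u v ≠ D.br u w := by rw [hv']; exact hwc.1.symm
    exact (iu.adj_iff hne).2 ⟨av', hwc.2,
      (hu.2.2 _ _ (iu.adj_br v) (iu.adj_br w)).2 ⟨hne, Or.inl hv'⟩⟩

/-! ### Labels are stars or cliques. -/

/-- Seen from `t`, the far side of a tree edge lies within a single branch. This is why a strong
split cannot separate the branches at `t` with at least two on either side. -/
theorem exists_forall_br_eq {t a b : N} (h : ¬ (t ≠ a ∧ D.T.toward a t = b)) :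
    ∃ u, ∀ v, D.leaf v ≠ a → D.T.toward a (D.leaf v) = b → D.br t v = u := by
  by_cases hta : t = a
  · subst hta
    exact ⟨b, fun v _ hv => hv⟩
  · refine ⟨D.T.toward t a, fun v h1 h2 => D.isTree.toward_eq_of_toward_ne hta h1 ?_⟩
    rw [h2]
    exact fun k => h ⟨hta, k.symm⟩

theorem IsInternal.isStarNode_or_isCliqueNode {t : N} [Finite V] (hG : G.Preconnected)
    (hP : G.P4Condition) (ht : D.IsInternal t) : D.IsStarNode t ∨ D.IsCliqueNode t := by
  have := D.finite
  let f : V → D.T.neighborSet t := fun v => ⟨D.br t v, ht.adj_br v⟩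
  have hf : ∀ u : D.T.neighborSet t, f (D.rep t u) = u := fun u => Subtype.ext (ht.br_rep u.2)
  have hfne : ∀ {v w}, f v ≠ f w → D.br t v ≠ D.br t w := fun h k => h (Subtype.ext k)
  have hadj : ∀ v w, f v ≠ f w → (G.Adj v w ↔ D.Active t v ∧ D.Active t w ∧
      (D.label t).Adj (f v) (f w)) := fun v w h => ht.adj_iff (hfne h)
  have hact : ∀ u : D.T.neighborSet t, D.Active t (D.rep t u) := fun u => ht.active_rep u.2
  have hH : (D.label t).Preconnected := by
    rw [preconnected_iff_exists_adj]
    rintro A ⟨a, ha⟩ ⟨b, hb⟩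
    obtain ⟨x, hx, y, hy, hxy⟩ := preconnected_iff_exists_adj.1 hG (f ⁻¹' A)
      ⟨D.rep t a, by rwa [Set.mem_preimage, hf]⟩
      ⟨D.rep t b, by rwa [Set.mem_compl_iff, Set.mem_preimage, hf]⟩
    have hne : f x ≠ f y := fun k => hy (show f y ∈ A from k ▸ hx)
    exact ⟨f x, hx, f y, hy, ((hadj x y hne).1 hxy).2.2⟩
  have hHP : (D.label t).P4Condition := hP.comap _
  suffices hc : ∀ J, IsSplit (D.label t) J → ∃ J', IsSplit (D.label t) J' ∧ (J ∩ J').Nonempty ∧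
      (Jᶜ ∩ J').Nonempty ∧ (J ∩ J'ᶜ).Nonempty ∧ (Jᶜ ∩ J'ᶜ).Nonempty by
    rcases eq_top_or_star_of_forall_crossed hH hHP.isDistanceHereditary hc with h | ⟨c, h⟩
    · exact Or.inr ⟨ht, h⟩
    · exact Or.inl ⟨c, ht, h⟩
  rintro J ⟨⟨a, ha, a', ha', haa'⟩, ⟨b, hb, b', hb', hbb'⟩, hcut⟩
  have mem : ∀ u : D.T.neighborSet t, D.rep t u ∈ f ⁻¹' J ↔ u ∈ J := fun u => by
    rw [Set.mem_preimage, hf]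
  have hsplit : IsSplit G (f ⁻¹' J) := by
    refine ⟨⟨_, (mem a).2 ha, _, (mem a').2 ha', fun k => haa' ?_⟩,
      ⟨_, fun k => hb ((mem b).1 k), _, fun k => hb' ((mem b').1 k), fun k => hbb' ?_⟩, ?_⟩
    · rw [← hf a, ← hf a', k]
    · rw [← hf b, ← hf b', k]
    · rintro x hx y hy ⟨y', hy', hxy'⟩ ⟨x', hx', hyx'⟩
      have ne : ∀ {x y}, x ∈ f ⁻¹' J → y ∈ (f ⁻¹' J)ᶜ → f x ≠ f y := fun hx hy k =>
        hy (show _ ∈ J from k ▸ hx)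
      have h1 := (hadj _ _ (ne hx hy')).1 hxy'
      have h2 := (hadj _ _ (ne hx' hy).symm).1 hyx'
      exact (hadj _ _ (ne hx hy)).2 ⟨h1.1, h2.1, hcut _ hx _ hy ⟨_, hy', h1.2.2⟩ ⟨_, hx', h2.2.2⟩⟩
  have hnstr : ¬ IsStrongSplit G (f ⁻¹' J) := by
    rw [D.isStrongSplit_iff]
    rintro ⟨p, q, hp, hq, hpq, he⟩
    have m : ∀ v, v ∈ f ⁻¹' J ↔ D.leaf v ≠ p ∧ D.T.toward p (D.leaf v) = q := fun v => by
      rw [he]; exact D.isTree.mem_side_iff hpq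
    by_cases hside : t ≠ p ∧ D.T.toward p t = q
    · obtain ⟨u, hu⟩ := exists_forall_br_eq ((D.isTree.mem_side_comm hpq).1 hside)
      have aux : ∀ b ∈ Jᶜ, (b : N) = u := by
        intro b hb
        have h1 := fun k => hb ((mem b).1 ((m _).2 k))
        have h2 : D.leaf (D.rep t b) ≠ q ∧ D.T.toward q (D.leaf (D.rep t b)) = p := by
          by_contra k
          exact h1 ((D.isTree.mem_side_comm hpq).2 k)
        rw [← hu _ h2.1 h2.2, ht.br_rep b.2]
      exact hbb' (Subtype.ext ((aux b hb).trans (aux b' hb').symm))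
    · obtain ⟨u, hu⟩ := exists_forall_br_eq hside
      have aux : ∀ a ∈ J, (a : N) = u := by
        intro a ha
        have h1 := (m _).1 ((mem a).2 ha)
        rw [← hu _ h1.1 h1.2, ht.br_rep a.2]
      exact haa' (Subtype.ext ((aux a ha).trans (aux a' ha').symm))
  have hcross : ∃ B, IsSplit G B ∧ (f ⁻¹' J ∩ B).Nonempty ∧ ((f ⁻¹' J)ᶜ ∩ B).Nonempty ∧
      (f ⁻¹' J ∩ Bᶜ).Nonempty ∧ ((f ⁻¹' J)ᶜ ∩ Bᶜ).Nonempty := by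
    by_contra hc
    refine hnstr ⟨hsplit, fun B hB => ?_⟩
    by_contra hn
    simp only [not_or, ← Set.nonempty_iff_ne_empty] at hn
    exact hc ⟨B, hB, hn⟩
  obtain ⟨B, hB, ⟨x1, h1, h1'⟩, ⟨x2, h2, h2'⟩, ⟨x3, h3, h3'⟩, ⟨x4, h4, h4'⟩⟩ := hcross
  -- `B` is a union of branches at `t`: it cannot cross the strong split of a branch, and neither
  -- `B` nor its complement fits into one branch, as both meet `J` and its complement.
  have hunion : ∀ v w, f v = f w → v ∈ B → w ∈ B := by
    intro v w hvw hv
    by_contra hw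
    have hbr : D.br t v = D.br t w := congrArg Subtype.val hvw
    by_cases hu : D.IsInternal (D.br t v)
    · have hstr : IsStrongSplit G (branchAt D.T D.leaf t (D.br t v)) :=
        (D.isStrongSplit_iff _).2 ⟨t, _, ht, hu, ht.adj_br v, rfl⟩
      have m := ht.mem_branchAt_iff (ht.adj_br v)
      have key : ∀ x y, f x ∈ J → f y ∉ J → D.br t x = D.br t v → D.br t y = D.br t v → False := by
        intro x y hx hy kx ky
        exact hy ((Subtype.ext (kx.trans ky.symm) : f x = f y) ▸ hx)
      rcases hstr.2 B hB with e | e | e | e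
      · exact Set.eq_empty_iff_forall_notMem.1 e v ⟨(m v).2 rfl, hv⟩
      · refine key x1 x2 h1 h2 ?_ ?_ <;> rw [← m] <;> by_contra k
        · exact Set.eq_empty_iff_forall_notMem.1 e x1 ⟨k, h1'⟩
        · exact Set.eq_empty_iff_forall_notMem.1 e x2 ⟨k, h2'⟩
      · exact Set.eq_empty_iff_forall_notMem.1 e w ⟨(m w).2 hbr.symm, hw⟩
      · refine key x3 x4 h3 h4 ?_ ?_ <;> rw [← m] <;> by_contra k
        · exact Set.eq_empty_iff_forall_notMem.1 e x3 ⟨k, h3'⟩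
        · exact Set.eq_empty_iff_forall_notMem.1 e x4 ⟨k, h4'⟩
    · rw [IsInternal, not_not] at hu
      obtain ⟨z, hz⟩ := hu
      have hzt : D.T.Adj t (D.leaf z) := hz ▸ ht.adj_br v
      have e1 := leaf_eq_of_toward_eq hzt (ht.leaf_ne v) hz.symm
      have e2 := leaf_eq_of_toward_eq hzt (ht.leaf_ne w) (hbr.symm.trans hz.symm)
      exact hw (e2.trans e1.symm ▸ hv)
  have memB : ∀ v, D.rep t (f v) ∈ B ↔ v ∈ B := fun v =>
    ⟨hunion _ _ (hf (f v)), hunion _ _ (hf (f v)).symm⟩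
  have neJ : ∀ {v w}, f v ∈ J → f w ∉ J → f v ≠ f w := fun hv hw k => hw (k ▸ hv)
  refine ⟨{u | D.rep t u ∈ B}, ⟨⟨f x1, (memB x1).2 h1', f x2, (memB x2).2 h2', neJ h1 h2⟩,
    ⟨f x3, fun k => h3' ((memB x3).1 k), f x4, fun k => h4' ((memB x4).1 k), neJ h3 h4⟩, ?_⟩,
    ⟨f x1, h1, (memB x1).2 h1'⟩, ⟨f x2, h2, (memB x2).2 h2'⟩,
    ⟨f x3, h3, fun k => h3' ((memB x3).1 k)⟩, ⟨f x4, h4, fun k => h4' ((memB x4).1 k)⟩⟩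
  rintro i hi j hj ⟨j', hj', hij'⟩ ⟨i', hi', hji'⟩
  exact hB.2.2 (D.rep t i) hi (D.rep t j) hj ⟨D.rep t j', hj', hij'⟩ ⟨D.rep t i', hi', hji'⟩

/-! ### Non-adjacency through blocking stars. -/

/-- The star at `t` with centre `c` is traversed between two of its leaves on the way from `v` to
`w`. -/
def Blocks (D : CanonicalSplitDecomposition G N) (t c : N) (v w : V) : Prop :=
  D.StarAt t c ∧ D.br t v ≠ D.br t w ∧ D.br t v ≠ c ∧ D.br t w ≠ c

theorem Blocks.symm {t c : N} {v w : V} (h : D.Blocks t c v w) : D.Blocks t c w v :=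
  ⟨h.1, h.2.1.symm, h.2.2.2, h.2.2.1⟩

theorem Blocks.not_adj {t c : N} {v w : V} (h : D.Blocks t c v w) : ¬ G.Adj v w := by
  intro hvw
  have h1 := ((h.1.1.adj_iff h.2.1).1 hvw).2.2
  rcases ((h.1.2.2 _ _ (h.1.1.adj_br v) (h.1.1.adj_br w)).1 h1).2 with k | k
  · exact h.2.2.1 k
  · exact h.2.2.2 k

/-- Follow the tree path from `v` to `w`, maintaining that `v` has a neighbour beyond the current
edge. At an unblocked node the label joins the two path edges, so the invariant moves on; at the
last edge the only vertex beyond is `w`. -/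
theorem exists_blocks [Nontrivial V] (hG : G.Preconnected)
    (hall : ∀ t, D.IsInternal t → D.IsStarNode t ∨ D.IsCliqueNode t) {v w : V} (hvw : v ≠ w)
    (hnadj : ¬ G.Adj v w) : ∃ t c, D.Blocks t c v w := by
  by_contra hnb
  have hT := D.isTree
  have key : ∀ {y z : N} (q : D.T.Walk y z), z = D.leaf w → ∀ x (h : D.T.Adj x y),
      (Walk.cons h q).IsPath → (D.leaf v ≠ y ∧ D.T.toward y (D.leaf v) = x) →
      (∃ z, D.leaf z ≠ x ∧ D.T.toward x (D.leaf z) = y ∧ G.Adj v z) → False := by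
    intro y z q
    induction q with
    | nil =>
      rintro rfl x h - - ⟨z, hz1, hz2, hz3⟩
      exact hnadj (leaf_eq_of_toward_eq h hz1 hz2 ▸ hz3)
    | @cons y y' _ h' q ih =>
      rintro hz x h hp ⟨hv1, hv2⟩ ⟨z, hz1, hz2, hz3⟩
      have hp' := (Walk.cons_isPath_iff _ _).1 hp
      have hxy' : x ≠ y' := by
        rintro rfl
        exact hp'.2 (by simp)
      have hy : D.IsInternal y := isInternal_of_adj h.symm h' hxy'
      have hbv : D.br y v = x := hv2
      have hbw : D.br y w = y' := by
        subst hz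
        exact hT.toward_cons h' q hp'.1
      have hbz : D.br y z ≠ x := fun k =>
        (hT.mem_side_comm h).1 ⟨hz1, hz2⟩ ⟨hy.leaf_ne z, k⟩
      have hr : G.Adj (D.rep y x) (D.rep y y') := by
        rcases hall y hy with hs | hk
        · obtain ⟨c, hs⟩ := isStarNode_iff.1 hs
          refine (hs.2.2 _ _ h.symm h').2 ⟨hxy', ?_⟩
          by_contra hn
          rw [not_or] at hn
          exact hnb ⟨y, c, hs, by rwa [hbv, hbw], by rw [hbv]; exact hn.1, by rw [hbw]; exact hn.2⟩
        · exact (isCliqueNode_iff.1 hk).2 _ _ h.symm h' hxy'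
      have hbr := hy.br_rep h'
      refine ih hz y h' hp'.1 ?_ ⟨D.rep y y', hy.leaf_ne _, hbr, ?_⟩
      · by_contra k
        exact hxy' (hv2.symm.trans ((hT.mem_side_comm h').2 k).2)
      · rw [hy.adj_iff (by rw [hbv, hbr]; exact hxy'), hbv, hbr]
        exact ⟨⟨z, by rwa [hbv], hz3⟩, hy.active_rep h', hr⟩
  have hlv : D.leaf w ≠ D.leaf v := fun k => hvw (D.leaf_injective k).symm
  obtain ⟨ha, q, hp⟩ := hT.exists_cons hlv
  obtain ⟨z, hz⟩ := hG.exists_adj_of_nontrivial v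
  have hzv : D.leaf z ≠ D.leaf v := fun k => hz.ne (D.leaf_injective k).symm
  exact key q rfl (D.leaf v) ha hp ⟨ha.ne, hT.toward_of_adj ha.symm⟩
    ⟨z, hzv, leaf_adj_unique (hT.adj_toward hzv) ha, hz⟩

end CanonicalSplitDecomposition

namespace CanonicalSplitDecomposition

variable {V N : Type*} {G : SimpleGraph V} {D : CanonicalSplitDecomposition G N}

theorem IsInternal.br_eq_of_ne {s t : N} {v : V} (hs : D.IsInternal s) (hts : t ≠ s)
    (h : D.br s v ≠ D.T.toward s t) : D.br t v = D.T.toward t s :=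
  D.isTree.toward_eq_of_toward_ne hts (hs.leaf_ne v) h

theorem StarAt.br_of_adj {t c : N} {v w : V} (ht : D.StarAt t c) (h : G.Adj v w) :
    D.br t v = D.br t w ∨ D.br t v = c ∨ D.br t w = c := by
  by_contra hn
  simp only [not_or] at hn
  exact Blocks.not_adj ⟨ht, hn.1, hn.2.1, hn.2.2⟩ h

theorem Blocks.br_eq_center {s cs : N} {a b c : V} (hs : D.Blocks s cs a c) (hab : G.Adj a b)
    (hbc : G.Adj b c) : D.br s b = cs := by
  rcases hs.1.br_of_adj hab with h | h | h
  · rcases hs.1.br_of_adj hbc with h' | h' | h'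
    · exact absurd (h.trans h') hs.2.1
    · exact h'
    · exact absurd h' hs.2.2.2
  · exact absurd h hs.2.2.1
  · exact h

/-! ### From diverging pairs of stars to the condition on induced paths. -/

/-- Two star nodes such that the star at the one does not point towards the other. -/
def Diverge (D : CanonicalSplitDecomposition G N) (s c s' c' : N) : Prop :=
  D.StarAt s c ∧ D.StarAt s' c' ∧ s ≠ s' ∧ D.T.toward s s' ≠ c ∧ D.T.toward s' s ≠ c'

theorem Diverge.symm {s c s' c' : N} (h : D.Diverge s c s' c') : D.Diverge s' c' s c :=
  ⟨h.2.1, h.1, h.2.2.1.symm, h.2.2.2.2, h.2.2.2.1⟩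

/-- If `s` pointed towards `s'`, then `s'` would point back, since `c` lies in its centre branch. A
star `r` blocking `a`, `d` then differs from both. If it is not between them, it also blocks `c`,
`d` or `a`, `b`; if it is between them, it blocks `b`, `c`. All these pairs are edges. -/
theorem toward_ne_of_induced_path {a b c d : V} (hab : G.Adj a b) (hbc : G.Adj b c)
    (hcd : G.Adj c d) (had : ∃ r cr, D.Blocks r cr a d) {s cs s' cs' : N}
    (hs : D.Blocks s cs a c) (hs' : D.Blocks s' cs' b d) : s ≠ s' ∧ D.T.toward s s' ≠ cs := by
  have hb := hs.br_eq_center hab hbc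
  have hc := hs'.br_eq_center hbc hcd
  have hne : s ≠ s' := by
    rintro rfl
    exact hs'.2.2.1 (hb.trans (hs.1.center_unique hs'.1))
  refine ⟨hne, fun hto => ?_⟩
  have is := hs.1.1
  have is' := hs'.1.1
  have hA : D.br s' a = D.T.toward s' s := is.br_eq_of_ne hne.symm (by rw [hto]; exact hs.2.2.1)
  have hC : D.br s' c = D.T.toward s' s := is.br_eq_of_ne hne.symm (by rw [hto]; exact hs.2.2.2)
  have hto' : D.T.toward s' s = cs' := hC.symm.trans hc
  have hD : D.br s d = D.T.toward s s' := is'.br_eq_of_ne hne (by rw [hto']; exact hs'.2.2.2)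
  obtain ⟨r, cr, hr⟩ := had
  have hrs : r ≠ s := by
    rintro rfl
    exact hr.2.2.2 (hD.trans (hto.trans (hs.1.center_unique hr.1)))
  have hrs' : r ≠ s' := by
    rintro rfl
    exact hr.2.2.1 (hA.trans (hto'.trans (hs'.1.center_unique hr.1)))
  have nab := hr.1.br_of_adj hab
  have nbc := hr.1.br_of_adj hbc
  have ncd := hr.1.br_of_adj hcd
  have K1 : ∀ v, D.br s v ≠ D.T.toward s r → D.br r v = D.T.toward r s :=
    fun v => is.br_eq_of_ne hrs
  have K2 : ∀ v, D.br s' v ≠ D.T.toward s' r → D.br r v = D.T.toward r s' :=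
    fun v => is'.br_eq_of_ne hrs'
  have K3 : D.T.toward s' r ≠ D.T.toward s' s → D.T.toward s r = D.T.toward s s' :=
    D.isTree.toward_eq_of_toward_ne hne hrs'
  have K4 : D.T.toward s r ≠ D.T.toward s s' → D.T.toward s' r = D.T.toward s' s :=
    D.isTree.toward_eq_of_toward_ne hne.symm hrs
  obtain ⟨-, r1, r2, r3⟩ := hr
  obtain ⟨-, p1, p2, p3⟩ := hs
  obtain ⟨-, q1, q2, q3⟩ := hs'
  have k1 : D.T.toward s' r = D.T.toward s' s := by
    by_contra k
    have k' := K3 k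
    have ea := K1 a (by rw [k', hto]; exact p2)
    have ec := K1 c (by rw [k', hto]; exact p3)
    clear K1 K2 K3 K4
    grind
  have k2 : D.T.toward s r = D.T.toward s s' := by
    by_contra k
    have k' := K4 k
    have eb := K2 b (by rw [k', hto']; exact q2)
    have ed := K2 d (by rw [k', hto']; exact q3)
    clear K1 K2 K3 K4
    grind
  have ea := K1 a (by rw [k2, hto]; exact p2)
  have ec := K1 c (by rw [k2, hto]; exact p3)
  have eb := K2 b (by rw [k1, hto']; exact q2)
  have ed := K2 d (by rw [k1, hto']; exact q3)
  clear K1 K2 K3 K4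
  grind

theorem diverge_of_induced_path {a b c d : V} (hab : G.Adj a b) (hbc : G.Adj b c)
    (hcd : G.Adj c d) (had : ∃ r cr, D.Blocks r cr a d) {s cs s' cs' : N}
    (hs : D.Blocks s cs a c) (hs' : D.Blocks s' cs' b d) : D.Diverge s cs s' cs' := by
  obtain ⟨r, cr, hr⟩ := had
  have h1 := toward_ne_of_induced_path hab hbc hcd ⟨r, cr, hr⟩ hs hs'
  have h2 := toward_ne_of_induced_path hcd.symm hbc.symm hab.symm ⟨r, cr, hr.symm⟩ hs'.symm hs.symm
  exact ⟨hs.1, hs'.1, h1.1, h1.2, h2.2⟩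

/-- A star other than `s`, `s'` points towards both, so two vertices that it blocks lie in the same
branch at `s` and in the same branch at `s'`. Comparing the branches of `x` with those of `b` and
`c` excludes missing both. A common neighbour of `a` and `d` would have to lie on the far side of
`s` from `s'` and also on the far side of `s'` from `s`. -/
theorem p4Condition_of_blocks [Nontrivial V] (hG : G.Preconnected)
    (hall : ∀ t, D.IsInternal t → D.IsStarNode t ∨ D.IsCliqueNode t) {s cs s' cs' : N}
    (hdiv : D.Diverge s cs s' cs')
    (ho : ∀ t c, D.StarAt t c → t ≠ s → t ≠ s' → D.T.toward t s = c ∧ D.T.toward t s' = c)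
    {a b c d x : V} (hab : G.Adj a b) (hbc : G.Adj b c) (hcd : G.Adj c d)
    (hs : D.Blocks s cs a c) (hs' : D.Blocks s' cs' b d) :
    (G.Adj x b ∨ G.Adj x c) ∧ ¬ (G.Adj x a ∧ G.Adj x d) := by
  have hb := hs.br_eq_center hab hbc
  have hc := hs'.br_eq_center hbc hcd
  have is := hs.1.1
  have is' := hs'.1.1
  obtain ⟨-, -, hne, n1, n2⟩ := hdiv
  have hsc : D.br s c = D.T.toward s s' := is'.br_eq_of_ne hne (by rw [hc]; exact n2.symm)
  have hsb : D.br s' b = D.T.toward s' s := is.br_eq_of_ne hne.symm (by rw [hb]; exact n1.symm)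
  constructor
  · by_contra hx
    rw [not_or] at hx
    have hxb : x ≠ b := by rintro rfl; exact hx.2 hbc
    have hxc : x ≠ c := by rintro rfl; exact hx.1 hbc.symm
    obtain ⟨t, ct, ht⟩ := exists_blocks hG hall hxb hx.1
    obtain ⟨t', ct', ht'⟩ := exists_blocks hG hall hxc hx.2
    have aux : ∀ {t ct : N} {y : V}, D.Blocks t ct x y → t ≠ s → t ≠ s' →
        D.br s x = D.br s y ∧ D.br s' x = D.br s' y := by
      intro t ct y ht h1 h2
      obtain ⟨e1, e2⟩ := ho t ct ht.1 h1 h2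
      have it := ht.1.1
      constructor
      · rw [it.br_eq_of_ne h1.symm (by rw [e1]; exact ht.2.2.1),
          it.br_eq_of_ne h1.symm (by rw [e1]; exact ht.2.2.2)]
      · rw [it.br_eq_of_ne h2.symm (by rw [e2]; exact ht.2.2.1),
          it.br_eq_of_ne h2.symm (by rw [e2]; exact ht.2.2.2)]
    have c1 : t ≠ s := by
      rintro rfl
      exact ht.2.2.2 (hb.trans (hs.1.center_unique ht.1))
    have c2 : t' ≠ s' := by
      rintro rfl
      exact ht'.2.2.2 (hc.trans (hs'.1.center_unique ht'.1))
    by_cases c3 : t = s'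
    · subst c3
      by_cases c4 : t' = s
      · subst c4
        have := is.br_eq_of_ne hne.symm (v := x) (by rw [← hsc]; exact ht'.2.1)
        exact ht.2.1 (this.trans hsb.symm)
      · have := (aux ht' c4 c2).2
        exact ht.2.2.1 (this.trans (hc.trans (hs'.1.center_unique ht.1)))
    · have k1 := (aux ht c1 c3).1
      by_cases c4 : t' = s
      · subst c4
        exact ht'.2.2.1 (k1.trans (hb.trans (hs.1.center_unique ht'.1)))
      · have k2 := (aux ht' c4 c2).1
        exact n1 (hsc.symm.trans (k2.symm.trans (k1.trans hb)))
  · rintro ⟨hxa, hxd⟩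
    have m1 := hs.1.br_of_adj hxa
    have m2 := hs'.1.br_of_adj hxd
    have m3 := is.br_eq_of_ne hne.symm (v := x)
    obtain ⟨-, p1, p2, p3⟩ := hs
    obtain ⟨-, q1, q2, q3⟩ := hs'
    grind

theorem p4Condition_of_diverge [Nontrivial V] (hG : G.Preconnected)
    (hall : ∀ t, D.IsInternal t → D.IsStarNode t ∨ D.IsCliqueNode t)
    (h : ∀ r cr r' cr', D.Diverge r cr r' cr' → ∃ s cs s' cs', D.Diverge s cs s' cs' ∧
      ∀ t c, D.StarAt t c → t ≠ s → t ≠ s' → D.T.toward t s = c ∧ D.T.toward t s' = c) :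
    G.P4Condition := by
  intro a b c d x hab hbc hcd hac hbd had
  have e1 : a ≠ c := by rintro rfl; exact had hcd
  have e2 : b ≠ d := by rintro rfl; exact had hab
  have e3 : a ≠ d := by rintro rfl; exact hac hcd.symm
  obtain ⟨r, cr, hr⟩ := exists_blocks hG hall e1 hac
  obtain ⟨r', cr', hr'⟩ := exists_blocks hG hall e2 hbd
  have hdiv := diverge_of_induced_path hab hbc hcd (exists_blocks hG hall e3 had) hr hr'
  obtain ⟨s, cs, s', cs', hss, ho⟩ := h r cr r' cr' hdiv
  -- Every diverging pair is the pair `s`, `s'`, because two diverging stars cannot both point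
  -- towards `s`.
  have claim : ∀ {r cr r' cr' : N}, D.Diverge r cr r' cr' → r = s ∨ r = s' := by
    intro r cr r' cr' hd
    by_contra hn
    rw [not_or] at hn
    obtain ⟨k1, k2⟩ := ho r cr hd.1 hn.1 hn.2
    obtain ⟨-, h', hne, n1, n2⟩ := hd
    have c1 : r' ≠ s := by rintro rfl; exact n1 k1
    have c2 : r' ≠ s' := by rintro rfl; exact n1 k2
    obtain ⟨k3, -⟩ := ho r' cr' h' c1 c2
    refine n2 ((D.isTree.toward_eq_of_toward_ne hne.symm (Ne.symm hn.1) ?_).symm.trans k3)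
    rw [k1]
    exact n1.symm
  rcases claim hdiv with rfl | rfl <;> rcases claim hdiv.symm with rfl | rfl
  · exact absurd rfl hdiv.2.2.1
  · exact p4Condition_of_blocks hG hall hdiv ho hab hbc hcd hr hr'
  · exact p4Condition_of_blocks hG hall hdiv (fun t c ht h1 h2 => (ho t c ht h2 h1).symm)
      hab hbc hcd hr hr'
  · exact absurd rfl hdiv.2.2.1

/-! ### Absence of diverging pairs and a common edge. -/

/-- What lies in the centre branch of one star of a diverging pair lies, seen from the other, in the
direction of the first star, which is not central. -/
theorem not_diverge_of_pointsTowardEdge {e : Sym2 N} (he : e ∈ D.T.edgeSet)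
    (h : ∀ t, D.IsStarNode t → D.PointsTowardEdge t e) (s c s' c' : N) :
    ¬ D.Diverge s c s' c' := by
  intro hd
  have spec : ∀ {t c : N}, D.StarAt t c → ∃ x y, e = s(x, y) ∧ x ≠ t ∧ D.T.toward t x = c ∧
      (y = t ∨ D.T.toward t y = c) := by
    intro t c ht
    obtain ⟨⟨c₁, hc₁⟩, hs, x, hxe, p, hp, hep, htp⟩ := h t (isStarNode_iff.2 ⟨c, ht⟩)
    have := ((isStarNodeWithCenter_iff hc₁).1 hs).center_unique ht
    subst this
    obtain ⟨y, rfl⟩ := Sym2.mem_iff_exists.1 hxe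
    have hx : x ≠ t := by
      rintro rfl
      cases p with
      | nil => simp at hep
      | cons hb q =>
        rw [Walk.cons_isPath_iff] at hp
        exact hp.2 q.end_mem_support
    have hxc := (isPath_mem_edges_iff hx).1 ⟨p, hp, htp⟩
    refine ⟨x, y, rfl, hx, hxc, ?_⟩
    by_cases hy : y = t
    · exact Or.inl hy
    · exact Or.inr ((D.isTree.toward_eq_of_adj he hx hy).symm.trans hxc)
  obtain ⟨h1, h2, hne, n1, n2⟩ := hd
  obtain ⟨x, y, e1, hx, hxc, hy⟩ := spec h1
  obtain ⟨x', y', e2, hx', hxc', hy'⟩ := spec h2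
  have K : ∀ z, z ≠ s → D.T.toward s z = c → D.T.toward s' z ≠ c' := by
    intro z hz hzc k
    refine n2 ((D.isTree.toward_eq_of_toward_ne hne.symm hz ?_).symm.trans k)
    rw [hzc]
    exact n1.symm
  rcases Sym2.eq_iff.1 (e1.symm.trans e2) with ⟨rfl, rfl⟩ | ⟨rfl, rfl⟩
  · exact K x hx hxc hxc'
  · rcases hy' with rfl | hy'
    · exact n1 hxc
    · exact K x hx hxc hy'

theorem StarAt.pointsTowardEdge_of_toward {t c s u : N} (ht : D.StarAt t c) (hs : D.T.Adj s u)
    (hts : t ≠ s) (h : D.T.toward t s = c) : D.PointsTowardEdge t s(s, u) := by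
  have aux : ∀ {s u : N}, D.T.Adj s u → t ≠ s → D.T.toward t s = c → D.T.toward s t = u →
      D.PointsTowardEdge t s(s, u) := by
    rintro s u hs hts h rfl
    obtain ⟨p, hp⟩ := D.isTree.connected.exists_isPath s t
    refine ⟨⟨c, ht.2.1⟩, (isStarNodeWithCenter_iff ht.2.1).2 ht, s, by simp, p.reverse,
      hp.reverse, ?_, ?_⟩
    · simpa using mem_edges_of_isPath hts p hp
    · have := mem_edges_of_isPath hts.symm p.reverse hp.reverse
      rwa [h] at this
  by_cases hu : D.T.toward s t = u
  · exact aux hs hts h hu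
  · have h1 : t ≠ u ∧ D.T.toward u t = s := by
      by_contra k
      exact hu ((D.isTree.mem_side_comm hs).2 k).2
    rw [Sym2.eq_swap]
    refine aux hs.symm h1.1 ?_ h1.2
    rw [← h]
    exact D.isTree.toward_eq_of_adj hs.symm h1.1.symm hts.symm

theorem exists_pointsTowardEdge [Finite V] [Nontrivial V]
    (h : ∀ s c s' c', ¬ D.Diverge s c s' c') :
    ∃ e ∈ D.T.edgeSet, ∀ t, D.IsStarNode t → D.PointsTowardEdge t e := by
  by_cases hst : ∃ p : N × N, D.StarAt p.1 p.2
  · obtain ⟨⟨s, cs⟩, hs, hmin⟩ := WellFounded.has_min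
      (measure fun p : N × N => {v | D.br p.1 v = p.2}.ncard).wf {p | D.StarAt p.1 p.2} hst
    have hs : D.StarAt s cs := hs
    refine ⟨s(s, cs), hs.2.1, fun t ht => ?_⟩
    obtain ⟨ct, ht⟩ := isStarNode_iff.1 ht
    by_cases hts : t = s
    · subst hts
      have := ht.center_unique hs
      subst this
      exact ⟨⟨ct, ht.2.1⟩, (isStarNodeWithCenter_iff ht.2.1).2 ht, ct, by simp,
        .cons ht.2.1 .nil, by simp [ht.2.1.ne], by simp, by simp⟩
    · refine ht.pointsTowardEdge_of_toward hs.2.1 hts ?_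
      by_contra hto
      have hto' : D.T.toward s t = cs := by
        by_contra k
        exact h t ct s cs ⟨ht, hs, hts, hto, k⟩
      -- A star `t` not pointing towards `s` lies in the centre branch of `s`, and its own centre
      -- branch is strictly smaller: it omits a third branch at `t`.
      refine hmin (t, ct) ht (Set.ncard_lt_ncard ⟨fun v hv => ?_, fun hsub => ?_⟩)
      · have hv : D.br t v = ct := hv
        exact (ht.1.br_eq_of_ne (Ne.symm hts) (by rw [hv]; exact Ne.symm hto)).trans hto'
      · obtain ⟨u, hu, hu1, hu2⟩ := ht.1.exists_adj_ne_ne ct (D.T.toward t s)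
        have hbr := ht.1.br_rep hu
        have : D.br t (D.rep t u) = ct := hsub
          ((ht.1.br_eq_of_ne (Ne.symm hts) (by rwa [hbr])).trans hto' :
            D.br s (D.rep t u) = cs)
        exact hu1 (hbr.symm.trans this)
  -- Without star nodes any edge of the tree serves.
  · have : Nontrivial N := D.leaf_injective.nontrivial
    obtain ⟨a, b, hab⟩ := exists_pair_ne N
    refine ⟨s(a, D.T.toward a b), D.isTree.adj_toward hab.symm, fun t ht => ?_⟩
    obtain ⟨c, hc⟩ := isStarNode_iff.1 ht
    exact absurd ⟨(t, c), hc⟩ hst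

/-! ### A closest diverging pair. -/

/-- The nodes strictly between `s` and `s'`. -/
def between (D : CanonicalSplitDecomposition G N) (s s' : N) : Set N :=
  {x | x ≠ s ∧ x ≠ s' ∧ D.T.toward x s ≠ D.T.toward x s'}

theorem between_comm (s s' : N) : D.between s s' = D.between s' s := by
  ext x
  simp only [between, Set.mem_ofPred_eq]
  tauto

theorem between_ssubset {s s' t : N} (ht : t ∈ D.between s s') :
    D.between s t ⊂ D.between s s' := by
  refine ⟨?_, fun h => (h ht).2.1 rfl⟩
  obtain ⟨h1, h2, h3⟩ := ht
  rintro x ⟨k1, k2, k3⟩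
  have hT := D.isTree
  refine ⟨k1, ?_, ?_⟩
  · rintro rfl
    exact k3 (hT.toward_eq_of_toward_ne k2 h1.symm h3)
  · by_cases hx : D.T.toward t s' = D.T.toward t x
    · exact absurd (hT.toward_eq_of_toward_ne k2 h1.symm (hx ▸ h3)) k3
    · rw [hT.toward_eq_of_toward_ne k2 h2.symm hx]
      exact k3

/-- Supplies the inner vertices of the induced path built later. If `t` lies outside the centre
branch of `s`, the representative of that branch serves. Otherwise the node `cs` is not `t`, and a
third branch at `cs` serves: the label there is a clique or a star centred at `s`, so this branch is
joined to that of `s`. -/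
theorem StarAt.exists_active {s cs t ct : N}
    (hall : ∀ t, D.IsInternal t → D.IsStarNode t ∨ D.IsCliqueNode t)
    (hs : D.StarAt s cs) (ht : D.StarAt t ct) (hst : s ≠ t) (hto : D.T.toward t s ≠ ct) :
    ∃ b, D.br s b = cs ∧ D.Active s b ∧ D.br t b = D.T.toward t s := by
  have is := hs.1
  by_cases hst' : D.T.toward s t = cs
  · have hadj := hs.2.1
    have hct : cs ≠ t := by
      rintro rfl
      have := hs.center_eq_of_adj ht
      rw [D.isTree.toward_of_adj hadj.symm] at hto
      exact hto this.symm
    have h1 : D.T.toward cs t ≠ s := fun k =>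
      (D.isTree.mem_side_comm hadj).1 ⟨hst.symm, hst'⟩ ⟨hct.symm, k⟩
    have hadj' := D.isTree.adj_toward (t := cs) (x := t) hct.symm
    have ic : D.IsInternal cs := isInternal_of_adj hadj' hadj.symm h1
    obtain ⟨u, hu, hu1, hu2⟩ := ic.exists_adj_ne_ne s (D.T.toward cs t)
    have hr : G.Adj (D.rep cs u) (D.rep cs s) := by
      rcases hall cs ic with hc | hc
      · obtain ⟨c', hc⟩ := isStarNode_iff.1 hc
        have := hs.center_eq_of_adj hc
        subst this
        exact (hc.2.2 _ _ hu hadj.symm).2 ⟨hu1, Or.inr rfl⟩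
      · exact (isCliqueNode_iff.1 hc).2 _ _ hu hadj.symm hu1
    have hbu := ic.br_rep hu
    have hbs := ic.br_rep hadj.symm
    have e1 : D.br s (D.rep cs u) = cs := (br_eq_iff is ic hadj _).2 (by rwa [hbu])
    refine ⟨D.rep cs u, e1, ⟨D.rep cs s, ?_, hr⟩, ?_⟩
    · rw [e1]
      exact fun k => (br_eq_iff is ic hadj _).1 k hbs
    · rw [ic.br_eq_of_ne hct.symm (by rwa [hbu])]
      exact D.isTree.toward_eq_of_adj hadj.symm hct hst
  · have hbr := is.br_rep hs.2.1
    exact ⟨D.rep s cs, hbr, is.active_rep hs.2.1,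
      is.br_eq_of_ne hst.symm (by rw [hbr]; exact Ne.symm hst')⟩

theorem exists_diverge_forall_toward [Nontrivial V] (hG : G.Preconnected) (hP : G.P4Condition)
    (hall : ∀ t, D.IsInternal t → D.IsStarNode t ∨ D.IsCliqueNode t)
    (h : ∃ p : (N × N) × (N × N), D.Diverge p.1.1 p.1.2 p.2.1 p.2.2) :
    ∃ s cs s' cs', D.Diverge s cs s' cs' ∧
      ∀ t c, D.StarAt t c → t ≠ s → t ≠ s' → D.T.toward t s = c ∧ D.T.toward t s' = c := by
  have := D.finite
  have hT := D.isTree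
  obtain ⟨⟨⟨s, cs⟩, ⟨s', cs'⟩⟩, hd, hmin⟩ := WellFounded.has_min
    (measure fun p : (N × N) × (N × N) => (D.between p.1.1 p.2.1).ncard).wf
    {p | D.Diverge p.1.1 p.1.2 p.2.1 p.2.2} h
  have hd : D.Diverge s cs s' cs' := hd
  refine ⟨s, cs, s', cs', hd, ?_⟩
  obtain ⟨hs, hs', hne, n1, n2⟩ := hd
  have is := hs.1
  have is' := hs'.1
  -- A star between `s` and `s'` fails to point towards one of them and would form a closer
  -- diverging pair with it.
  have notmid : ∀ t c, D.StarAt t c → t ≠ s → t ≠ s' → D.T.toward t s = D.T.toward t s' := by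
    intro t c ht h1 h2
    by_contra hto
    have e1 : D.T.toward s s' = D.T.toward s t :=
      hT.toward_eq_of_toward_ne h1.symm h2.symm (Ne.symm hto)
    have e2 : D.T.toward s' s = D.T.toward s' t := hT.toward_eq_of_toward_ne h2.symm h1.symm hto
    by_cases hc : D.T.toward t s = c
    · refine hmin ((s', cs'), (t, c)) ⟨hs', ht, h2.symm, by rwa [← e2], ?_⟩
        (Set.ncard_lt_ncard ?_)
      · rw [← hc]
        exact Ne.symm hto
      · change D.between s' t ⊂ D.between s s'
        rw [between_comm s s']
        exact between_ssubset ⟨h2, h1, Ne.symm hto⟩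
    · exact hmin ((s, cs), (t, c)) ⟨hs, ht, h1.symm, by rwa [← e1], hc⟩
        (Set.ncard_lt_ncard (between_ssubset ⟨h1, h2, hto⟩))
  intro t ct ht h1 h2
  have e := notmid t ct ht h1 h2
  by_cases hc : D.T.toward t s = ct
  · exact ⟨hc, e ▸ hc⟩
  exfalso
  -- If `t` does not point towards the pair, then `b` and `c` in the centre branches together with
  -- non-central representatives at `s` and `s'` form an induced path. A representative from a
  -- non-central branch at `t`, away from the pair, is blocked from both `b` and `c`.
  obtain ⟨b, hb, ab, htb⟩ := hs.exists_active hall ht h1.symm hc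
  obtain ⟨c, hc', ac, htc⟩ := hs'.exists_active hall ht h2.symm (e ▸ hc)
  obtain ⟨ua, hua, ua1, ua2⟩ := is.exists_adj_ne_ne cs (D.T.toward s s')
  obtain ⟨ud, hud, ud1, ud2⟩ := is'.exists_adj_ne_ne cs' (D.T.toward s' s)
  obtain ⟨ux, hux, ux1, ux2⟩ := ht.1.exists_adj_ne_ne ct (D.T.toward t s)
  have ba := is.br_rep hua
  have bd := is'.br_rep hud
  have bx := ht.1.br_rep hux
  have hsc : D.br s c = D.T.toward s s' := is'.br_eq_of_ne hne (by rw [hc']; exact n2.symm)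
  have hsd : D.br s (D.rep s' ud) = D.T.toward s s' := is'.br_eq_of_ne hne (by rwa [bd])
  have hsb : D.br s' b = D.T.toward s' s := is.br_eq_of_ne hne.symm (by rw [hb]; exact n1.symm)
  have hbc : G.Adj b c := by
    by_contra hbc
    have hbc' : b ≠ c := by
      rintro rfl
      exact n1 (hsc.symm.trans hb)
    obtain ⟨r, cr, hr⟩ := exists_blocks hG hall hbc' hbc
    have c1 : r ≠ s := by
      rintro rfl
      exact hr.2.2.1 (hb.trans (hs.center_unique hr.1))
    have c2 : r ≠ s' := by
      rintro rfl
      exact hr.2.2.2 (hc'.trans (hs'.center_unique hr.1))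
    have er := notmid r cr hr.1 c1 c2
    -- If `r` lies in the centre branch of `s`, a neighbour of `b` outside that branch is in the
    -- same branch at `r` as `c`, so `r` would block an edge. The same holds at `s'`. Otherwise `b`
    -- and `c` lie in one branch at `r`.
    by_cases k1 : D.T.toward s r = cs
    · obtain ⟨z, hz, hbz⟩ := ab
      have z1 : D.br r z = D.T.toward r s := is.br_eq_of_ne c1 (by rwa [k1, ← hb])
      have z2 : D.br r c = D.T.toward r s := is.br_eq_of_ne c1 (by rwa [k1, hsc])
      obtain ⟨r0, r1, r2, r3⟩ := hr
      rw [z2, ← z1] at r1 r3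
      exact Blocks.not_adj ⟨r0, r1, r2, r3⟩ hbz
    by_cases k2 : D.T.toward s' r = cs'
    · obtain ⟨z, hz, hcz⟩ := ac
      have z1 : D.br r z = D.T.toward r s' := is'.br_eq_of_ne c2 (by rwa [k2, ← hc'])
      have z2 : D.br r b = D.T.toward r s' := is'.br_eq_of_ne c2 (by rwa [k2, hsb])
      obtain ⟨r0, r1, r2, r3⟩ := hr.symm
      rw [z2, ← z1] at r1 r3
      exact Blocks.not_adj ⟨r0, r1, r2, r3⟩ hcz
    · apply hr.2.1
      rw [is.br_eq_of_ne c1 (by rw [hb]; exact Ne.symm k1),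
        is'.br_eq_of_ne c2 (by rw [hc']; exact Ne.symm k2), er]
  have hab : G.Adj (D.rep s ua) b := by
    rw [is.adj_iff (by rwa [ba, hb]), ba, hb]
    exact ⟨is.active_rep hua, ab, (hs.2.2 _ _ hua hs.2.1).2 ⟨ua1, Or.inr rfl⟩⟩
  have hdc : G.Adj (D.rep s' ud) c := by
    rw [is'.adj_iff (by rwa [bd, hc']), bd, hc']
    exact ⟨is'.active_rep hud, ac, (hs'.2.2 _ _ hud hs'.2.1).2 ⟨ud1, Or.inr rfl⟩⟩
  have hac : D.Blocks s cs (D.rep s ua) c :=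
    ⟨hs, by rwa [ba, hsc], by rwa [ba], by rwa [hsc]⟩
  have had : D.Blocks s cs (D.rep s ua) (D.rep s' ud) :=
    ⟨hs, by rwa [ba, hsd], by rwa [ba], by rwa [hsd]⟩
  have hbd : D.Blocks s' cs' b (D.rep s' ud) :=
    ⟨hs', by rw [bd, hsb]; exact ud2.symm, by rwa [hsb], by rwa [bd]⟩
  have hxb : D.Blocks t ct (D.rep t ux) b := ⟨ht, by rwa [bx, htb], by rwa [bx], by rwa [htb]⟩
  have hxc : D.Blocks t ct (D.rep t ux) c :=
    ⟨ht, by rwa [bx, htc, ← e], by rwa [bx], by rwa [htc, ← e]⟩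
  rcases (hP _ _ _ _ (D.rep t ux) hab hbc hdc.symm hac.not_adj hbd.not_adj had.not_adj).1 with k | k
  · exact hxb.not_adj k
  · exact hxc.not_adj k

end CanonicalSplitDecomposition

/-! ### The main theorem. -/

open CanonicalSplitDecomposition in
theorem mainTheorem2 {V N : Type*} [Finite V] [Nontrivial V] (G : SimpleGraph V)
    (hG : G.Connected) (D : CanonicalSplitDecomposition G N) :
    (IsDistanceHereditary G ∧ IsDistanceHereditary Gᶜ) ↔
      (∀ t, D.IsInternal t → D.IsStarNode t ∨ D.IsCliqueNode t) ∧
      ((∃ e ∈ D.T.edgeSet, ∀ t, D.IsStarNode t → D.PointsTowardEdge t e) ∨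
        (∃ s s', D.IsStarNode s ∧ D.IsStarNode s' ∧
          ¬ D.PointsTowardNode s s' ∧ ¬ D.PointsTowardNode s' s ∧
          D.T.Adj s s' ∧
          ∀ t, D.IsStarNode t → t ≠ s → t ≠ s' →
            D.PointsTowardNode t s ∧ D.PointsTowardNode t s') ∨
        (∃ s s' s'', D.IsStarNode s ∧ D.IsStarNode s' ∧ s ≠ s' ∧
          ¬ D.PointsTowardNode s s' ∧ ¬ D.PointsTowardNode s' s ∧
          D.IsCliqueNode s'' ∧ D.T.Adj s s'' ∧ D.T.Adj s'' s' ∧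
          ∀ t, D.IsStarNode t → t ≠ s → t ≠ s' →
            D.PointsTowardNode t s ∧ D.PointsTowardNode t s' ∧ D.PointsTowardNode t s'')) := by
  rw [isDistanceHereditary_and_compl_iff]
  have hT := D.isTree
  constructor
  · intro hP
    have hall : ∀ t, D.IsInternal t → D.IsStarNode t ∨ D.IsCliqueNode t :=
      fun t ht => ht.isStarNode_or_isCliqueNode hG.preconnected hP
    refine ⟨hall, ?_⟩
    by_cases hex : ∃ p : (N × N) × (N × N), D.Diverge p.1.1 p.1.2 p.2.1 p.2.2
    swap
    · exact Or.inl (exists_pointsTowardEdge fun s c s' c' hd => hex ⟨((s, c), (s', c')), hd⟩)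
    right
    obtain ⟨s, cs, s', cs', ⟨hs, hs', hne, n1, n2⟩, ho⟩ :=
      exists_diverge_forall_toward hG.preconnected hP hall hex
    have np : ¬ D.PointsTowardNode s s' := fun k => n1 (hs.pointsTowardNode_iff.1 k).2
    have np' : ¬ D.PointsTowardNode s' s := fun k => n2 (hs'.pointsTowardNode_iff.1 k).2
    have sn := isStarNode_iff.2 ⟨cs, hs⟩
    have sn' := isStarNode_iff.2 ⟨cs', hs'⟩
    have pts : ∀ t, D.IsStarNode t → t ≠ s → t ≠ s' →
        D.PointsTowardNode t s ∧ D.PointsTowardNode t s' := by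
      intro t ht h1 h2
      obtain ⟨c, ht⟩ := isStarNode_iff.1 ht
      have := ho t c ht h1 h2
      exact ⟨ht.pointsTowardNode_iff.2 ⟨h1.symm, this.1⟩,
        ht.pointsTowardNode_iff.2 ⟨h2.symm, this.2⟩⟩
    by_cases hadj : D.T.Adj s s'
    · exact Or.inl ⟨s, s', sn, sn', np, np', hadj, pts⟩
    right
    -- An internal node between `s` and `s'` is a clique node: a star there would have to point both
    -- ways.
    have mid : ∀ {x y}, D.T.Adj x y → y ≠ s → y ≠ s' → D.T.toward y s = x → D.T.toward y s' ≠ x →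
        D.IsInternal y → D.IsCliqueNode y := by
      intro x y _ h1 h2 h3 h4 hy
      refine (hall y hy).resolve_left fun k => ?_
      obtain ⟨c, hc⟩ := isStarNode_iff.1 k
      have := ho y c hc h1 h2
      exact h4 (this.2.trans (this.1.symm.trans h3))
    have a1 : D.T.Adj s (D.T.toward s s') := hT.adj_toward hne.symm
    generalize hq : D.T.toward s s' = q at a1
    have hqs' : q ≠ s' := by rintro rfl; exact hadj a1
    have hqs : D.T.toward q s' ≠ s := fun k =>
      (hT.mem_side_comm a1).1 ⟨hne.symm, hq⟩ ⟨hqs'.symm, k⟩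
    have a2 : D.T.Adj q (D.T.toward q s') := hT.adj_toward hqs'.symm
    have iq : D.IsInternal q := isInternal_of_adj a2 a1.symm hqs
    have kq : D.IsCliqueNode q := mid a1 a1.ne' hqs' (hT.toward_of_adj a1.symm) hqs iq
    -- A second node between `s` and `s'` would give two adjacent clique nodes.
    have hq' : D.T.toward q s' = s' := by
      by_contra hqq
      generalize hr : D.T.toward q s' = r at a2 hqq hqs
      have hrq : D.T.toward r s' ≠ q := fun k =>
        (hT.mem_side_comm a2).1 ⟨hqs'.symm, hr⟩ ⟨Ne.symm hqq, k⟩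
      have a3 : D.T.Adj r (D.T.toward r s') := hT.adj_toward (Ne.symm hqq)
      have ir : D.IsInternal r := isInternal_of_adj a3 a2.symm hrq
      have hrs : D.T.toward r s = q := by
        rw [hT.toward_eq_of_adj a1 hqs.symm a2.ne, hT.toward_of_adj a2.symm]
      exact not_isCliqueNode_of_adj a2 kq (mid a2 hqs hqq hrs hrq ir)
    rw [hq'] at a2
    refine ⟨s, s', q, sn, sn', hne, np, np', kq, a1, a2, fun t ht h1 h2 => ?_⟩
    obtain ⟨k1, k2⟩ := pts t ht h1 h2
    refine ⟨k1, k2, ?_⟩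
    obtain ⟨c, ht⟩ := isStarNode_iff.1 ht
    have htq : t ≠ q := by
      rintro rfl
      exact ht.not_isCliqueNode kq
    refine ht.pointsTowardNode_iff.2 ⟨htq.symm, ?_⟩
    rw [hT.toward_eq_of_adj a1.symm htq.symm h1.symm]
    exact (ht.pointsTowardNode_iff.1 k1).2
  · rintro ⟨hall, h⟩
    have pair : ∀ s s', D.IsStarNode s → D.IsStarNode s' → s ≠ s' → ¬ D.PointsTowardNode s s' →
        ¬ D.PointsTowardNode s' s → (∀ t, D.IsStarNode t → t ≠ s → t ≠ s' →
          D.PointsTowardNode t s ∧ D.PointsTowardNode t s') → G.P4Condition := by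
      intro s s' hs hs' hne np np' ho
      obtain ⟨c, hc⟩ := isStarNode_iff.1 hs
      obtain ⟨c', hc'⟩ := isStarNode_iff.1 hs'
      refine p4Condition_of_diverge hG.preconnected hall fun _ _ _ _ _ => ⟨s, c, s', c',
        ⟨hc, hc', hne, fun k => np (hc.pointsTowardNode_iff.2 ⟨hne.symm, k⟩),
          fun k => np' (hc'.pointsTowardNode_iff.2 ⟨hne, k⟩)⟩, fun t ct ht h1 h2 => ?_⟩
      have := ho t (isStarNode_iff.2 ⟨ct, ht⟩) h1 h2
      exact ⟨(ht.pointsTowardNode_iff.1 this.1).2, (ht.pointsTowardNode_iff.1 this.2).2⟩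
    rcases h with ⟨e, he, h⟩ | ⟨s, s', hs, hs', np, np', hadj, ho⟩ |
      ⟨s, s', s'', hs, hs', hne, np, np', -, -, -, ho⟩
    · exact p4Condition_of_diverge hG.preconnected hall fun r cr r' cr' hd =>
        absurd hd (not_diverge_of_pointsTowardEdge he h r cr r' cr')
    · exact pair s s' hs hs' hadj.ne np np' ho
    · exact pair s s' hs hs' hne np np' fun t ht h1 h2 => ⟨(ho t ht h1 h2).1, (ho t ht h1 h2).2.1⟩
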